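/- Theorem 5 (sink degree, binary model). Random series-parallel networks are grown in the binary model as follows. Step $1$ starts with a single directed edge, labelled $1$, from the source to the sink. In step $n\ge 2$ one of the $n-1$ present edges is chosen uniformly at random, say edge $j=(x,y)$. If $x$ has out-degree $1$, a new parallel edge $(x,y)$ labelled $n$ is added. Otherwise $(x,y)$ is replaced by two edges $(x,z)$ and $(z,y)$, with $z$ a new vertex, where $(x,z)$ gets the label $j$ and $(z,y)$ gets the label $n$. Let $D_n$ be the (in-)degree of the sink in the resulting random network with $n$ edges. Then: (a) For every $n\ge 1$, $$\mathbb{E}(D_n)=\frac{1+\sqrt2}{2}\binom{n+\sqrt2-2}{n-1}-\frac{\sqrt2-1}{2}\binom{n-\sqrt2-2}{n-1},$$ where $\binom{x}{k}=x(x-1)\cdots(x-k+1)/k!$ for real $x$, and, as $n\to\infty$, $$\mathbb{E}(D_n)\sim\frac{1+\sqrt2}{2}\,\frac{n^{\sqrt2-1}}{\Gamma(\sqrt2)}.$$ (b) As $n\to\infty$, $D_n/n^{\sqrt2-1}$ converges in distribution to a random variable $D$ whose law is uniquely determined by its integer moments, all of which are finite and given by $$\mathbb{E}(D^r)=\frac{r!\,\bigl(r(\sqrt2-1)+1\bigr)\,\tilde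 c_r}{\Gamma\bigl(r(\sqrt2-1)+1\bigr)},\qquad r\ge 0,$$ where $\tilde c_0=1$, $\tilde c_1=\frac{1+\sqrt2}{2\sqrt2}$ and $$\tilde c_r=\frac{1}{\bigl(r(\sqrt2-1)+1\bigr)^2-2}\sum_{k=1}^{r-1}\tilde c_k\,\tilde c_{r-k},\qquad r\ge 2.$$ -/

import Mathlib

open MeasureTheory ProbabilityTheory Filter Topology Asymptotics

namespace BinarySP

/-- A directed multigraph with `n` labelled edges. The edge with label `k + 1` is `G k`, an ordered
pair (tail, head) of vertices. Vertices are natural numbers; `0` is the source, `1` is the sink. -/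
abbrev Network (n : ℕ) : Type := Fin n → ℕ × ℕ

/-- Number of edges with tail `x`. -/
def outDegree {n : ℕ} (G : Network n) (x : ℕ) : ℕ :=
  (Finset.univ.filter fun e : Fin n => (G e).1 = x).card

/-- Number of edges with head `x`. -/
def inDegree {n : ℕ} (G : Network n) (x : ℕ) : ℕ :=
  (Finset.univ.filter fun e : Fin n => (G e).2 = x).card

/-- The degree of the sink (all edges at the sink are directed towards it). -/
def sinkDegree {n : ℕ} (G : Network n) : ℕ := inDegree G 1

/-- The edge-duplication applied to the edge `j = (x, y)` of a network with `n` edges.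
If the tail `x` has out-degree `1`, a parallel edge `(x, y)` is added as the last edge.
Otherwise `(x, y)` is replaced by the edges `(x, z)` (keeping the label of `j`) and `(z, y)`
(the last edge), where `z = n + 1` is a new vertex: all vertices of networks with `n ≥ 1` edges
produced by the growth process are at most `n`. -/
def duplicate {n : ℕ} (G : Network n) (j : Fin n) : Network (n + 1) :=
  if outDegree G (G j).1 = 1 then
    Fin.snoc (α := fun _ => ℕ × ℕ) G (G j)
  else
    Fin.snoc (α := fun _ => ℕ × ℕ) (Function.update G j ((G j).1, n + 1)) (n + 1, (G j).2)

/-- The law of the random network of size `n` (number of edges) in the binary model: size `1` is a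
single edge from the source to the sink; to pass to the next size, one of the present edges is
chosen uniformly at random, independently of the past, and duplicated.
(Size `0` is the empty network, by convention; it plays no role.) -/
noncomputable def law : (n : ℕ) → PMF (Network n)
  | 0 => PMF.pure fun _ => (0, 1)
  | 1 => PMF.pure fun _ => (0, 1)
  | n + 2 =>
    (law (n + 1)).bind fun G =>
      (PMF.uniformOfFintype (Fin (n + 1))).map fun j => duplicate G j

end BinarySP

/-! Call an edge into the sink parallel or serial according to whether its tail has out-degree one;
let `p`, `s` be their numbers. Choosing a parallel edge at the sink makes `(p, s)` into `(p - 1, s +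
2)`, a serial one makes it `(p + 1, s - 1)`, and any other edge changes nothing. So the sink degree
`p + s` is read off a two-colour urn whose generator is `urnGenerator`; if `Φ` is an eigenfunction
with eigenvalue `μ`, step `n` multiplies the mean of `Φ` by `1 + μ / n` (`urnMean_eigen`). Linear
functions have the eigenvalues `√2 - 1` and `-√2 - 1`, which gives the exact expectation.

Higher moments need eigenfunctions of higher degree. Write `g = √2 - 1` and `θ = X d/dX`. The
recursion for the `c r` says that the series `B = ∑ c r X ^ r` and `A = (1 + gθ) B` satisfy `gθA =
B² - A` and `gθB = A - B`. By the Leibniz rule `gθ` acts on `A ^ p * B ^ s` exactly as the urn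
generator does, so the coefficient of `X ^ r` is an eigenfunction with eigenvalue `r g`
(`urnGenerator_coeff`). Its leading part is `leadingStat ^ r / r!` (`exists_abs_coeff_sub_le`), and
its mean is an explicit product of Gamma type, so all moments of `leadingStat` converge after
scaling. The degree differs from `leadingStat` by a multiple of `deviation`, whose second moment is
only of order `n ^ g`, so the degree has the same limiting moments (`tendsto_urnMean_degree_pow`).

Since `0 ≤ c r ≤ 1` and Gamma beats every exponential, the limiting moments determine a law, and the
method of moments (`exists_tendsto_of_moments`) gives weak convergence. -/

namespace BinarySP

/-! ### The urn of sink edges -/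

/-- Number of edges into the sink whose tail has out-degree `1`. -/
def parCount {n : ℕ} (G : Network n) : ℕ :=
  (Finset.univ.filter fun e : Fin n => (G e).2 = 1 ∧ outDegree G (G e).1 = 1).card

/-- Number of edges into the sink whose tail has out-degree different from `1`. -/
def serCount {n : ℕ} (G : Network n) : ℕ :=
  (Finset.univ.filter fun e : Fin n => (G e).2 = 1 ∧ outDegree G (G e).1 ≠ 1).card

theorem sinkDegree_eq {n : ℕ} (G : Network n) : sinkDegree G = parCount G + serCount G := by
  unfold sinkDegree inDegree parCount serCount
  rw [← Finset.filter_filter, ← Finset.filter_filter, Finset.card_filter_add_card_filter_not]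

theorem outDegree_snoc {n : ℕ} (G : Network n) (e : ℕ × ℕ) (x : ℕ) :
    outDegree (Fin.snoc (α := fun _ => ℕ × ℕ) G e : Network (n + 1)) x
      = outDegree G x + if e.1 = x then 1 else 0 := by
  simp only [outDegree, Finset.card_filter, Fin.sum_univ_castSucc, Fin.snoc_castSucc, Fin.snoc_last]

theorem outDegree_update {n : ℕ} (G : Network n) (j : Fin n) (z x : ℕ) :
    outDegree (Function.update G j ((G j).1, z) : Network n) x = outDegree G x := by
  unfold outDegree
  congr 1
  ext i
  by_cases h : i = j
  · subst h; simp
  · simp [Function.update_of_ne h]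

theorem tail_eq_iff_of_outDegree_eq_one {n : ℕ} {G : Network n} {j : Fin n}
    (h : outDegree G (G j).1 = 1) (i : Fin n) : (G i).1 = (G j).1 ↔ i = j := by
  obtain ⟨a, ha⟩ := Finset.card_eq_one.1 h
  have h1 : ∀ i, (G i).1 = (G j).1 ↔ i = a := fun i => by
    simpa using Finset.ext_iff.1 ha i
  rw [h1 i, (h1 j).1 rfl]

theorem outDegree_eq_zero {n : ℕ} {G : Network n} {x : ℕ} (h : ∀ e, (G e).1 ≠ x) :
    outDegree G x = 0 := by
  simp [outDegree, h]

/-- Effect of the duplication of an edge whose tail has out-degree `1`. -/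
theorem counts_duplicate_par {n : ℕ} (G : Network n) (j : Fin n)
    (h : outDegree G (G j).1 = 1) :
    parCount (duplicate G j) + (if (G j).2 = 1 then 1 else 0) = parCount G ∧
    serCount (duplicate G j) = serCount G + 2 * (if (G j).2 = 1 then 1 else 0) := by
  have hd : duplicate G j = Fin.snoc (α := fun _ => ℕ × ℕ) G (G j) := if_pos h
  rw [hd]
  unfold parCount serCount
  simp only [Finset.card_filter, Fin.sum_univ_castSucc, Fin.snoc_castSucc, Fin.snoc_last,
    outDegree_snoc]
  simp only [eq_comm (a := (G j).1), tail_eq_iff_of_outDegree_eq_one h]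
  constructor
  · rw [← Finset.add_sum_erase _ _ (Finset.mem_univ j),
      ← Finset.add_sum_erase _ _ (Finset.mem_univ j)]
    rw [Finset.sum_congr rfl (g := fun i => if (G i).2 = 1 ∧ outDegree G (G i).1 = 1 then 1 else 0)]
    · by_cases h2 : (G j).2 = 1 <;> simp [h, h2, add_comm]
    · intro i hi
      simp [Finset.ne_of_mem_erase hi]
  · rw [← Finset.add_sum_erase _ _ (Finset.mem_univ j),
      ← Finset.add_sum_erase _ _ (Finset.mem_univ j)]
    rw [Finset.sum_congr rfl (g := fun i => if (G i).2 = 1 ∧ outDegree G (G i).1 ≠ 1 then 1 else 0)]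
    · by_cases h2 : (G j).2 = 1
      · simp [h, h2]; ring
      · simp [h, h2]
    · intro i hi
      simp [Finset.ne_of_mem_erase hi]

/-- Effect of the duplication of an edge whose tail has out-degree different from `1`. -/
theorem counts_duplicate_ser {n : ℕ} (G : Network n) (j : Fin n) (hG : ∀ e, (G e).1 ≤ n)
    (h : outDegree G (G j).1 ≠ 1) :
    parCount (duplicate G j) = parCount G + (if (G j).2 = 1 then 1 else 0) ∧
    serCount (duplicate G j) + (if (G j).2 = 1 then 1 else 0) = serCount G := by
  have hn : n ≠ 0 := fun h0 => by subst h0; exact j.elim0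
  have hd : duplicate G j = Fin.snoc (α := fun _ => ℕ × ℕ)
      (Function.update G j ((G j).1, n + 1)) (n + 1, (G j).2) := if_neg h
  have hz : outDegree G (n + 1) = 0 := outDegree_eq_zero fun e => by have := hG e; omega
  have hne : ∀ e, ¬ (n + 1 = (G e).1) := fun e => by have := hG e; omega
  have htail : ∀ i, (Function.update G j ((G j).1, n + 1) i).1 = (G i).1 := fun i => by
    by_cases hi : i = j
    · subst hi; simp
    · simp [Function.update_of_ne hi]
  rw [hd]
  unfold parCount serCount
  simp only [Finset.card_filter, Fin.sum_univ_castSucc, Fin.snoc_castSucc, Fin.snoc_last,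
    outDegree_snoc, outDegree_update, htail, hz, hne]
  constructor
  · rw [← Finset.add_sum_erase _ _ (Finset.mem_univ j),
      ← Finset.add_sum_erase _ _ (Finset.mem_univ j)]
    rw [Finset.sum_congr rfl (g := fun i => if (G i).2 = 1 ∧ outDegree G (G i).1 = 1 then 1 else 0)]
    · by_cases h2 : (G j).2 = 1 <;> simp [h, h2]
    · intro i hi
      simp [Finset.ne_of_mem_erase hi]
  · rw [← Finset.add_sum_erase _ _ (Finset.mem_univ j),
      ← Finset.add_sum_erase _ _ (Finset.mem_univ j)]
    rw [Finset.sum_congr rfl (g := fun i => if (G i).2 = 1 ∧ outDegree G (G i).1 ≠ 1 then 1 else 0)]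
    · by_cases h2 : (G j).2 = 1 <;> simp [h, h2, hn, add_comm]
    · intro i hi
      simp [Finset.ne_of_mem_erase hi]

theorem tail_duplicate_le {n : ℕ} (G : Network n) (j : Fin n) (hG : ∀ e, (G e).1 ≤ n)
    (e : Fin (n + 1)) : (duplicate G j e).1 ≤ n + 1 := by
  unfold duplicate
  split_ifs
  · refine Fin.lastCases ?_ (fun i => ?_) e
    · simpa using (hG j).trans (Nat.le_succ n)
    · simpa using (hG i).trans (Nat.le_succ n)
  · refine Fin.lastCases ?_ (fun i => ?_) e
    · simp
    · simp only [Fin.snoc_castSucc]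
      by_cases hi : i = j
      · subst hi; simpa using (hG i).trans (Nat.le_succ n)
      · simpa [Function.update_of_ne hi] using (hG i).trans (Nat.le_succ n)

/-- The generator of the urn of sink edges. -/
def urnGenerator (Φ : ℕ → ℕ → ℝ) (p s : ℕ) : ℝ :=
  p * (Φ (p - 1) (s + 2) - Φ p s) + s * (Φ (p + 1) (s - 1) - Φ p s)

/-- Only edges into the sink change the counts, and they split into `p` of one kind and `s` of the
other. Truncated subtraction in the generator is harmless: at `p = 0` or `s = 0` the term has weight
zero. -/
theorem sum_duplicate {n : ℕ} (G : Network n) (hG : ∀ e, (G e).1 ≤ n) (Φ : ℕ → ℕ → ℝ) :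
    ∑ j, Φ (parCount (duplicate G j)) (serCount (duplicate G j))
      = n * Φ (parCount G) (serCount G) + urnGenerator Φ (parCount G) (serCount G) := by
  set p := parCount G with hp
  set s := serCount G with hs
  have key : ∀ j, Φ (parCount (duplicate G j)) (serCount (duplicate G j)) = Φ p s
      + ((if (G j).2 = 1 ∧ outDegree G (G j).1 = 1 then 1 else 0) * (Φ (p - 1) (s + 2) - Φ p s)
      + (if (G j).2 = 1 ∧ outDegree G (G j).1 ≠ 1 then 1 else 0)
        * (Φ (p + 1) (s - 1) - Φ p s)) := by
    intro j
    by_cases h : outDegree G (G j).1 = 1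
    · obtain ⟨h1, h2⟩ := counts_duplicate_par G j h
      by_cases h3 : (G j).2 = 1
      · rw [if_pos h3] at h1 h2
        rw [show p - 1 = parCount (duplicate G j) by omega,
          show s + 2 = serCount (duplicate G j) by omega]
        simp [h, h3]
      · rw [if_neg h3] at h1 h2
        rw [show p = parCount (duplicate G j) by omega,
          show s = serCount (duplicate G j) by omega]
        simp [h3]
    · obtain ⟨h1, h2⟩ := counts_duplicate_ser G j hG h
      by_cases h3 : (G j).2 = 1
      · rw [if_pos h3] at h1 h2
        rw [show p + 1 = parCount (duplicate G j) by omega,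
          show s - 1 = serCount (duplicate G j) by omega]
        simp [h, h3]
      · rw [if_neg h3] at h1 h2
        rw [show p = parCount (duplicate G j) by omega,
          show s = serCount (duplicate G j) by omega]
        simp [h3]
  simp_rw [key]
  rw [Finset.sum_add_distrib, Finset.sum_add_distrib, ← Finset.sum_mul, ← Finset.sum_mul,
    urnGenerator, hp, hs, parCount, serCount, Finset.card_filter, Finset.card_filter]
  simp

/-! ### Integration against the law -/

theorem finite_support_law : ∀ n, (law n).support.Finite
  | 0 => by simp [law, PMF.support_pure]
  | 1 => by simp [law, PMF.support_pure]
  | n + 2 => by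
    simp only [law, PMF.support_bind, PMF.support_map]
    exact (finite_support_law (n + 1)).biUnion fun G _ => (Set.toFinite _).image _

/-- The type of networks is infinite, but the law has finite support; no later integrability
question is more than this. -/
theorem integrable_law (n : ℕ) (f : Network n → ℝ) : Integrable f (law n).toMeasure := by
  have h : IntegrableOn f (law n).support (law n).toMeasure :=
    IntegrableOn.of_finite (finite_support_law n)
  rwa [IntegrableOn, PMF.restrict_toMeasure_support] at h

/-- Turns the growth step into a kernel composition, so that Fubini for kernels applies. -/
theorem toMeasure_bind {α β : Type*} [MeasurableSpace α] [MeasurableSpace β] [Countable α]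
    [DiscreteMeasurableSpace α] (p : PMF α) (κ : Kernel α β) (q : α → PMF β)
    (h : ∀ a, κ a = (q a).toMeasure) : (p.bind q).toMeasure = p.toMeasure.bind κ := by
  ext s hs
  rw [PMF.toMeasure_bind_apply _ _ _ hs, Measure.bind_apply hs κ.aemeasurable, lintegral_countable']
  refine tsum_congr fun a => ?_
  rw [h, PMF.toMeasure_apply_singleton _ _ (measurableSet_singleton a), mul_comm]

theorem integral_law_one (f : Network 1 → ℝ) :
    ∫ G, f G ∂(law 1).toMeasure = f fun _ => (0, 1) := by
  simp [law, PMF.toMeasure_pure]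

theorem integral_law_succ {n : ℕ} (hn : 1 ≤ n) (f : Network (n + 1) → ℝ) :
    ∫ G, f G ∂(law (n + 1)).toMeasure
      = ∫ G, (n : ℝ)⁻¹ * ∑ j, f (duplicate G j) ∂(law n).toMeasure := by
  obtain ⟨m, rfl⟩ : ∃ m, n = m + 1 := ⟨n - 1, by omega⟩
  let q : Network (m + 1) → PMF (Network (m + 2)) := fun G =>
    (PMF.uniformOfFintype (Fin (m + 1))).map fun j => duplicate G j
  let κ : Kernel (Network (m + 1)) (Network (m + 2)) := Kernel.ofFunOfCountable fun G =>
    (q G).toMeasure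
  have h : (law (m + 2)).toMeasure = (law (m + 1)).toMeasure.bind κ :=
    toMeasure_bind _ κ q fun _ => rfl
  have hf := integrable_law (m + 2) f
  rw [h] at hf
  change ∫ G, f G ∂(law (m + 2)).toMeasure = _
  rw [h]
  rw [Measure.comp_eq_comp_const_apply] at hf ⊢
  rw [Kernel.integral_comp hf, Kernel.const_apply]
  congr 1
  ext G
  change ∫ x, f x ∂(q G).toMeasure = _
  rw [← PMF.toMeasure_map _ _ (Measurable.of_discrete), integral_map (by fun_prop)
    (Measurable.of_discrete.aestronglyMeasurable), PMF.integral_eq_sum, Finset.mul_sum]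
  have hm : ((m : ENNReal) + 1).toReal = m + 1 := by exact_mod_cast ENNReal.toReal_natCast (m + 1)
  simp [hm]

/-- Guarantees that the vertex `n + 1` introduced by a serial step is not yet a tail, as
`sum_duplicate` requires. -/
theorem ae_tail_le : ∀ n, 1 ≤ n → ∀ᵐ G ∂(law n).toMeasure, ∀ e, (G e).1 ≤ n := by
  intro n hn
  have key : ∀ G ∈ (law n).support, ∀ e, (G e).1 ≤ n := by
    induction n, hn using Nat.le_induction with
    | base => simp [law, PMF.support_pure]
    | succ n hn ih =>
      obtain ⟨m, rfl⟩ : ∃ m, n = m + 1 := ⟨n - 1, by omega⟩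
      intro G hG
      simp only [law, PMF.support_bind, PMF.support_map, Set.mem_iUnion, Set.mem_image] at hG
      obtain ⟨G', hG', j, -, rfl⟩ := hG
      exact tail_duplicate_le G' j (ih G' hG')
  rw [ae_iff, PMF.toMeasure_apply_eq_zero_iff _ (Set.to_countable _).measurableSet]
  exact Set.disjoint_left.2 fun G hG h => h (key G hG)

/-- Expectation of a function of the numbers of sink edges of the two kinds. -/
noncomputable def urnMean (n : ℕ) (Φ : ℕ → ℕ → ℝ) : ℝ :=
  ∫ G, Φ (parCount G) (serCount G) ∂(law n).toMeasure

theorem urnMean_one (Φ : ℕ → ℕ → ℝ) : urnMean 1 Φ = Φ 1 0 := by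
  rw [urnMean, integral_law_one]
  rfl

theorem urnMean_add (n : ℕ) (Φ Ψ : ℕ → ℕ → ℝ) :
    urnMean n (fun p s => Φ p s + Ψ p s) = urnMean n Φ + urnMean n Ψ :=
  integral_add (integrable_law n _) (integrable_law n _)

theorem urnMean_sub (n : ℕ) (Φ Ψ : ℕ → ℕ → ℝ) :
    urnMean n (fun p s => Φ p s - Ψ p s) = urnMean n Φ - urnMean n Ψ :=
  integral_sub (integrable_law n _) (integrable_law n _)

theorem urnMean_const_mul (n : ℕ) (c : ℝ) (Φ : ℕ → ℕ → ℝ) :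
    urnMean n (fun p s => c * Φ p s) = c * urnMean n Φ :=
  integral_const_mul _ _

theorem urnMean_const (n : ℕ) (c : ℝ) : urnMean n (fun _ _ => c) = c := by
  simp [urnMean]

theorem urnMean_mono (n : ℕ) {Φ Ψ : ℕ → ℕ → ℝ} (h : ∀ p s, Φ p s ≤ Ψ p s) :
    urnMean n Φ ≤ urnMean n Ψ :=
  integral_mono (integrable_law n _) (integrable_law n _) fun _ => h _ _

theorem urnMean_nonneg (n : ℕ) {Φ : ℕ → ℕ → ℝ} (h : ∀ p s, 0 ≤ Φ p s) : 0 ≤ urnMean n Φ :=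
  integral_nonneg fun _ => h _ _

theorem abs_urnMean_le (n : ℕ) (Φ : ℕ → ℕ → ℝ) :
    |urnMean n Φ| ≤ urnMean n fun p s => |Φ p s| :=
  abs_integral_le_integral_abs

theorem urnMean_succ {n : ℕ} (hn : 1 ≤ n) (Φ : ℕ → ℕ → ℝ) :
    urnMean (n + 1) Φ = urnMean n fun p s => Φ p s + (n : ℝ)⁻¹ * urnGenerator Φ p s := by
  rw [urnMean, integral_law_succ hn, urnMean]
  refine integral_congr_ae ?_
  filter_upwards [ae_tail_le n hn] with G hG
  rw [sum_duplicate G hG]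
  have : (n : ℝ) ≠ 0 := by positivity
  field_simp

theorem urnMean_eigen {Φ : ℕ → ℕ → ℝ} {μ : ℝ} (h : ∀ p s, urnGenerator Φ p s = μ * Φ p s)
    {n : ℕ} (hn : 1 ≤ n) :
    urnMean n Φ = (∏ k ∈ Finset.Ico 1 n, (1 + μ / k)) * Φ 1 0 := by
  induction n, hn using Nat.le_induction with
  | base => simp [urnMean_one]
  | succ n hn ih =>
    rw [urnMean_succ hn, Finset.prod_Ico_succ_top hn, mul_right_comm, ← ih, mul_comm,
      ← urnMean_const_mul]
    congr 1
    ext p s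
    rw [h]
    ring

/-! ### The method of moments on the real line -/

/-- All powers are integrable against `μ`, with integrals `m r`. -/
def HasMoments (μ : Measure ℝ) (m : ℕ → ℝ) : Prop :=
  ∀ r, Integrable (fun x : ℝ => x ^ r) μ ∧ ∫ x, x ^ r ∂μ = m r

/-- The derivative of the remainder of order `n + 1` is `I` times that of order `n`, and the bounds
differentiate in the same way; the base case is `|exp (i y)| = 1`. -/
theorem norm_exp_mul_I_sub_sum_le_of_nonneg (n : ℕ) : ∀ y : ℝ, 0 ≤ y →
    ‖Complex.exp (y * Complex.I) - ∑ k ∈ Finset.range n, (y * Complex.I) ^ k / k.factorial‖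
      ≤ y ^ n / n.factorial := by
  induction n with
  | zero => intro y _; simp [Complex.norm_exp_ofReal_mul_I]
  | succ n ih =>
    intro y hy
    have hd : ∀ x : ℝ, HasDerivAt (fun y : ℝ => Complex.exp (y * Complex.I)
        - ∑ k ∈ Finset.range (n + 1), (y * Complex.I) ^ k / k.factorial)
        (Complex.I * (Complex.exp (x * Complex.I)
          - ∑ k ∈ Finset.range n, (x * Complex.I) ^ k / k.factorial)) x := by
      intro x
      have h0 : HasDerivAt (fun y : ℝ => (y : ℂ) * Complex.I) Complex.I x := by
        simpa using (Complex.ofRealCLM.hasDerivAt (x := x)).mul_const Complex.I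
      have h1 := h0.cexp
      have h2 : HasDerivAt (fun y : ℝ => ∑ k ∈ Finset.range (n + 1),
          ((y : ℂ) * Complex.I) ^ k / k.factorial)
          (∑ k ∈ Finset.range (n + 1),
            (k * ((x : ℂ) * Complex.I) ^ (k - 1) * Complex.I) / k.factorial) x :=
        HasDerivAt.fun_sum fun k _ => (h0.pow k).div_const _
      refine (h1.sub h2).congr_deriv (Eq.symm ?_)
      rw [Finset.sum_range_succ', mul_sub, Finset.mul_sum, mul_comm Complex.I]
      simp only [Nat.cast_zero, zero_mul, zero_div, add_zero, Nat.add_sub_cancel]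
      congr 1
      refine Finset.sum_congr rfl fun k _ => ?_
      rw [Nat.factorial_succ]
      have : (k.factorial : ℂ) ≠ 0 := by exact_mod_cast k.factorial_ne_zero
      have : ((k : ℂ) + 1) ≠ 0 := by exact_mod_cast k.succ_ne_zero
      push_cast
      field_simp
    have hB : ∀ x : ℝ, HasDerivAt (fun y : ℝ => y ^ (n + 1) / (n + 1).factorial)
        (x ^ n / n.factorial) x := by
      intro x
      refine ((hasDerivAt_pow (n + 1) x).div_const ((n + 1).factorial : ℝ)).congr_deriv (Eq.symm ?_)
      rw [Nat.factorial_succ]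
      have : (n.factorial : ℝ) ≠ 0 := by positivity
      push_cast
      field_simp
    refine image_norm_le_of_norm_deriv_right_le_deriv_boundary (a := 0) (b := y)
      (fun x _ => (hd x).continuousAt.continuousWithinAt) (fun x _ => (hd x).hasDerivWithinAt)
      ?_ hB (fun x hx => ?_) (Set.right_mem_Icc.2 hy)
    · simp [Finset.sum_range_succ']
    · rw [norm_mul, Complex.norm_I, one_mul]
      exact ih x hx.1

theorem norm_exp_mul_I_sub_sum_le (n : ℕ) (y : ℝ) :
    ‖Complex.exp (y * Complex.I) - ∑ k ∈ Finset.range n, (y * Complex.I) ^ k / k.factorial‖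
      ≤ |y| ^ n / n.factorial := by
  rcases le_total 0 y with hy | hy
  · rw [abs_of_nonneg hy]
    exact norm_exp_mul_I_sub_sum_le_of_nonneg n y hy
  · have h := norm_exp_mul_I_sub_sum_le_of_nonneg n (-y) (by linarith)
    rw [abs_of_nonpos hy, ← Complex.norm_conj]
    convert h using 2
    simp [← Complex.exp_conj]

/-- The even order `2 * R` makes the absolute moment in the remainder an ordinary one. -/
theorem norm_charFun_sub_sum_le {μ : Measure ℝ} [IsProbabilityMeasure μ] {m : ℕ → ℝ}
    (h : HasMoments μ m) (t : ℝ) (R : ℕ) :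
    ‖charFun μ t - ∑ k ∈ Finset.range (2 * R), (t * Complex.I) ^ k / k.factorial * m k‖
      ≤ t ^ (2 * R) * m (2 * R) / (2 * R).factorial := by
  have hexp : Integrable (fun x : ℝ => Complex.exp (t * x * Complex.I)) μ := by
    refine Integrable.of_bound (C := 1) (by fun_prop) (ae_of_all _ fun x => ?_)
    rw [← Complex.ofReal_mul, Complex.norm_exp_ofReal_mul_I]
  have hint : ∀ k, Integrable (fun x : ℝ => (t * Complex.I) ^ k / k.factorial
      * ((x ^ k : ℝ) : ℂ)) μ := fun k => (h k).1.ofReal.const_mul _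
  have hsum : ∑ k ∈ Finset.range (2 * R), (t * Complex.I) ^ k / k.factorial * m k
      = ∫ x, ∑ k ∈ Finset.range (2 * R), (t * Complex.I) ^ k / k.factorial * ((x ^ k : ℝ) : ℂ) ∂μ := by
    rw [integral_finsetSum _ fun k _ => hint k]
    refine Finset.sum_congr rfl fun k _ => ?_
    rw [integral_const_mul, ← (h k).2, ← integral_complex_ofReal]
  rw [charFun_apply_real, hsum, ← integral_sub hexp (integrable_finsetSum _ fun k _ => hint k)]
  have h2 : t ^ (2 * R) * m (2 * R) / (2 * R).factorial
      = ∫ x, t ^ (2 * R) / (2 * R).factorial * x ^ (2 * R) ∂μ := by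
    rw [integral_const_mul, (h _).2]; ring
  rw [h2]
  refine norm_integral_le_of_norm_le ((h _).1.const_mul _) (ae_of_all _ fun x => ?_)
  have h3 := norm_exp_mul_I_sub_sum_le (2 * R) (t * x)
  rw [(even_two_mul R).pow_abs, mul_pow] at h3
  convert h3 using 1
  · push_cast
    congr 2
    refine Finset.sum_congr rfl fun k _ => ?_
    ring
  · ring

/-- A measure whose even moments do not grow too fast is determined by its moments. -/
theorem HasMoments.unique {μ ν : Measure ℝ} [IsProbabilityMeasure μ] [IsProbabilityMeasure ν]
    {m : ℕ → ℝ} (hμ : HasMoments μ m) (hν : HasMoments ν m)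
    (hm : ∀ t : ℝ, Tendsto (fun r : ℕ => t ^ r * m r / r.factorial) atTop (𝓝 0)) : μ = ν := by
  refine Measure.ext_of_charFun (funext fun t => ?_)
  rw [← sub_eq_zero, ← norm_le_zero_iff]
  have h2 : Tendsto (fun R : ℕ => 2 * R) atTop atTop := tendsto_id.const_mul_atTop' two_pos
  have h3 : Tendsto (fun R : ℕ => 2 * (t ^ (2 * R) * m (2 * R) / (2 * R).factorial)) atTop (𝓝 0) := by
    simpa using ((hm t).comp h2).const_mul 2
  refine ge_of_tendsto' h3 fun R => ?_
  have h4 := norm_sub_le_norm_sub_add_norm_sub (charFun μ t)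
    (∑ k ∈ Finset.range (2 * R), (t * Complex.I) ^ k / k.factorial * m k) (charFun ν t)
  have h5 := norm_charFun_sub_sum_le hμ t R
  have h6 := norm_charFun_sub_sum_le hν t R
  rw [norm_sub_rev] at h6
  linarith

/-! ### Truncated powers and moments of weak limits -/

/-- Truncation of a real number to the interval `[-K, K]`. -/
def clamp (K x : ℝ) : ℝ := max (-K) (min x K)

theorem continuous_clamp (K : ℝ) : Continuous (clamp K) := by
  unfold clamp; fun_prop

theorem abs_clamp_le {K : ℝ} (hK : 0 ≤ K) (x : ℝ) : |clamp K x| ≤ K := by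
  unfold clamp
  rw [abs_le]
  exact ⟨le_max_left _ _, max_le (by linarith) (min_le_right _ _)⟩

theorem clamp_eq_self {K x : ℝ} (h : |x| ≤ K) : clamp K x = x := by
  unfold clamp
  rw [min_eq_left (abs_le.1 h).2, max_eq_right (abs_le.1 h).1]

theorem abs_clamp_le_abs {K : ℝ} (hK : 0 ≤ K) (x : ℝ) : |clamp K x| ≤ |x| := by
  rcases le_total |x| K with h | h
  · rw [clamp_eq_self h]
  · exact (abs_clamp_le hK x).trans h

/-- Where truncation acts, `|x| / K ≥ 1`, so a factor `(|x| / K) ^ (r + 2)` is free. That exponent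
makes the total power of `x` even, and the right side integrates to a moment. -/
theorem abs_pow_sub_clamp_pow_le {K : ℝ} (hK : 0 < K) (r : ℕ) (x : ℝ) :
    |x ^ r - clamp K x ^ r| ≤ 2 / K ^ (r + 2) * x ^ (2 * (r + 1)) := by
  rcases le_total |x| K with h | h
  · rw [clamp_eq_self h, sub_self, abs_zero]
    have : 0 ≤ x ^ (2 * (r + 1)) := (even_two_mul _).pow_nonneg x
    positivity
  · have h1 : |x ^ r - clamp K x ^ r| ≤ 2 * |x| ^ r := by
      calc |x ^ r - clamp K x ^ r| ≤ |x ^ r| + |clamp K x ^ r| := abs_sub _ _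
        _ ≤ |x| ^ r + |x| ^ r := by
          rw [abs_pow, abs_pow]
          exact add_le_add_right (pow_le_pow_left₀ (abs_nonneg _) (abs_clamp_le_abs hK.le x) r) _
        _ = _ := by ring
    refine h1.trans ?_
    rw [div_mul_eq_mul_div, le_div_iff₀ (by positivity), mul_assoc]
    gcongr
    rw [← (even_two_mul (r + 1)).pow_abs]
    calc |x| ^ r * K ^ (r + 2) ≤ |x| ^ r * |x| ^ (r + 2) := by gcongr
      _ = _ := by ring

/-- The bounded continuous function `x ↦ clamp K x ^ r`. -/
noncomputable def clampPow (K : ℝ) (hK : 0 ≤ K) (r : ℕ) : BoundedContinuousFunction ℝ ℝ :=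
  BoundedContinuousFunction.ofNormedAddCommGroup (fun x => clamp K x ^ r)
    ((continuous_clamp K).pow r) (K ^ r) fun x => by
      rw [norm_pow, Real.norm_eq_abs]
      gcongr
      exact abs_clamp_le hK x

@[simp] theorem clampPow_apply (K : ℝ) (hK : 0 ≤ K) (r : ℕ) (x : ℝ) :
    clampPow K hK r x = clamp K x ^ r := rfl

theorem tendsto_clamp_pow (r : ℕ) (x : ℝ) :
    Tendsto (fun K : ℕ => clamp K x ^ r) atTop (𝓝 (x ^ r)) := by
  refine tendsto_const_nhds.congr' ?_
  filter_upwards [eventually_ge_atTop ⌈|x|⌉₊] with K hK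
  rw [clamp_eq_self (Nat.ceil_le.1 hK)]

theorem integrable_pow_of_even {μ : Measure ℝ} [IsFiniteMeasure μ]
    (h : ∀ r, Integrable (fun x : ℝ => x ^ (2 * r)) μ) (r : ℕ) :
    Integrable (fun x : ℝ => x ^ r) μ := by
  refine Integrable.mono' ((integrable_const (1 : ℝ)).add (h r)) (by fun_prop)
    (ae_of_all _ fun x => ?_)
  simp only [Pi.add_apply, norm_pow, Real.norm_eq_abs]
  rw [pow_mul', ← sq_abs, abs_pow]
  nlinarith [sq_nonneg (|x| ^ r - 1)]

/-- Convergence of all moments along a filter and weak convergence imply that the limits of the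
moments are the moments of the limit. -/
theorem HasMoments.of_tendsto {ι : Type*} {F : Filter ι} [F.NeBot] {μs : ι → ProbabilityMeasure ℝ}
    {ν : ProbabilityMeasure ℝ} {m : ℕ → ℝ} (hν : Tendsto μs F (𝓝 ν))
    (hint : ∀ i r, Integrable (fun x : ℝ => x ^ r) (μs i : Measure ℝ))
    (hm : ∀ r, Tendsto (fun i => ∫ x, x ^ r ∂(μs i : Measure ℝ)) F (𝓝 (m r))) :
    HasMoments (ν : Measure ℝ) m := by
  rw [ProbabilityMeasure.tendsto_iff_forall_integral_tendsto] at hν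
  -- Fatou along `K → ∞`: each truncated even power is bounded and continuous, so its integral
  -- passes to the weak limit and stays below `m (2 * r)`.
  have hev : ∀ r, Integrable (fun x : ℝ => x ^ (2 * r)) (ν : Measure ℝ) := by
    intro r
    refine integrable_of_tendsto (G := fun (K : ℕ) x => clamp K x ^ (2 * r))
      (ae_of_all _ fun x => tendsto_clamp_pow _ x)
      (fun K => ((continuous_clamp K).pow _).aestronglyMeasurable) ?_
    refine ne_top_of_le_ne_top (ENNReal.ofReal_ne_top (r := m (2 * r)))
      (liminf_le_of_le (by isBoundedDefault) fun b hb => ?_)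
    obtain ⟨K, hK⟩ := hb.exists
    refine hK.trans ?_
    have h0 : ∀ x, 0 ≤ clamp (K : ℝ) x ^ (2 * r) := fun x => (even_two_mul r).pow_nonneg _
    have h1 : ∫⁻ x, ‖clamp (K : ℝ) x ^ (2 * r)‖ₑ ∂(ν : Measure ℝ)
        = ENNReal.ofReal (∫ x, clamp (K : ℝ) x ^ (2 * r) ∂(ν : Measure ℝ)) := by
      have h2 : Integrable (fun x => clamp (K : ℝ) x ^ (2 * r)) (ν : Measure ℝ) :=
        (clampPow K (by positivity) (2 * r)).integrable (ν : Measure ℝ)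
      rw [ofReal_integral_eq_lintegral_ofReal h2 (ae_of_all _ h0)]
      refine lintegral_congr fun x => ?_
      rw [Real.enorm_of_nonneg (h0 x)]
    rw [h1]
    refine ENNReal.ofReal_le_ofReal ?_
    refine le_of_tendsto_of_tendsto' (hν (clampPow K (by positivity) (2 * r))) (hm (2 * r)) ?_
    intro i
    refine integral_mono ((clampPow K (by positivity) (2 * r)).integrable _) (hint i _) fun x => ?_
    simp only [clampPow_apply]
    rw [← (even_two_mul r).pow_abs, ← (even_two_mul r).pow_abs x]
    exact pow_le_pow_left₀ (abs_nonneg _) (abs_clamp_le_abs (by positivity) x) _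
  have hνint := integrable_pow_of_even hev
  intro r
  refine ⟨hνint r, ?_⟩
  have hbound : ∀ (μ : ProbabilityMeasure ℝ), (∀ r, Integrable (fun x : ℝ => x ^ r) (μ : Measure ℝ)) →
      ∀ K : ℝ, (hK : 0 < K) → |∫ x, x ^ r ∂(μ : Measure ℝ) - ∫ x, clampPow K hK.le r x ∂(μ : Measure ℝ)|
        ≤ 2 / K ^ (r + 2) * ∫ x, x ^ (2 * (r + 1)) ∂(μ : Measure ℝ) := by
    intro μ hμ K hK
    rw [← integral_sub (hμ r) ((clampPow K hK.le r).integrable _), ← integral_const_mul]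
    rw [← Real.norm_eq_abs]
    refine norm_integral_le_of_norm_le ((hμ _).const_mul _) (ae_of_all _ fun x => ?_)
    exact abs_pow_sub_clamp_pow_le hK r x
  rw [← sub_eq_zero, ← abs_nonpos_iff]
  -- `C` adds the truncation errors of `ν` and of the limit along `F`. Both carry the factor `2 / K
  -- ^ (r + 2)`, so letting the level grow finishes; the level is `K + 1` to keep it positive.
  set C := ∫ x, x ^ (2 * (r + 1)) ∂(ν : Measure ℝ) + m (2 * (r + 1)) with hC
  have hlim : Tendsto (fun K : ℕ => 2 / ((K : ℝ) + 1) ^ (r + 2) * C) atTop (𝓝 0) := by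
    have h1 : Tendsto (fun K : ℕ => ((K : ℝ) + 1) ^ (r + 2)) atTop atTop :=
      (tendsto_pow_atTop (by omega)).comp (tendsto_natCast_atTop_atTop.atTop_add tendsto_const_nhds)
    simpa using (h1.const_div_atTop 2).mul_const C
  refine ge_of_tendsto' hlim fun K => ?_
  have hK : (0 : ℝ) < K + 1 := by positivity
  have h1 := hbound ν hνint _ hK
  have h2 : |m r - ∫ x, clampPow _ hK.le r x ∂(ν : Measure ℝ)|
      ≤ 2 / ((K : ℝ) + 1) ^ (r + 2) * m (2 * (r + 1)) :=
    le_of_tendsto_of_tendsto' ((hm r).sub (hν _)).abs ((hm _).const_mul _)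
      fun i => hbound (μs i) (hint i) _ hK
  rw [hC, mul_add]
  calc _ = |(∫ x, x ^ r ∂(ν : Measure ℝ) - ∫ x, clampPow _ hK.le r x ∂(ν : Measure ℝ))
        - (m r - ∫ x, clampPow _ hK.le r x ∂(ν : Measure ℝ))| := by congr 1; ring
    _ ≤ _ := (abs_sub _ _).trans (add_le_add h1 h2)

/-- **Method of moments**: if all moments converge and the limits do not grow too fast, then there
is a weak limit, with these moments. -/
theorem exists_tendsto_of_moments {μs : ℕ → ProbabilityMeasure ℝ} {m : ℕ → ℝ}
    (hint : ∀ n r, Integrable (fun x : ℝ => x ^ r) (μs n : Measure ℝ))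
    (hlim : ∀ r, Tendsto (fun n => ∫ x, x ^ r ∂(μs n : Measure ℝ)) atTop (𝓝 (m r)))
    (hm : ∀ t : ℝ, Tendsto (fun r : ℕ => t ^ r * m r / r.factorial) atTop (𝓝 0)) :
    ∃ D : ProbabilityMeasure ℝ, HasMoments (D : Measure ℝ) m ∧ Tendsto μs atTop (𝓝 D) := by
  obtain ⟨C, hC⟩ := (hlim 2).bddAbove_range
  replace hC : ∀ n, ∫ x, x ^ 2 ∂(μs n : Measure ℝ) ≤ C := fun n => hC ⟨n, rfl⟩
  have hC0 : 0 ≤ C := (integral_nonneg fun x => sq_nonneg x).trans (hC 0)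
  -- Tightness from bounded second moments: outside the ball of radius `k + 1` one has `x ^ 2 ≥ k +
  -- 1`, so Markov's inequality bounds the mass by `C / (k + 1)`.
  let u : ℕ → NNReal := fun k => C.toNNReal * ((k : NNReal) + 1)⁻¹
  have hu : Tendsto u atTop (𝓝 0) := by
    simpa [u, one_div] using (tendsto_one_div_add_atTop_nhds_zero_nat (𝕜 := NNReal)).const_mul C.toNNReal
  have hcomp := isCompact_setOfPred_probabilityMeasure_mass_eq_compl_isCompact_le (E := ℝ) hu
    (fun k : ℕ => isCompact_closedBall (0 : ℝ) ((k : ℝ) + 1)) (Or.inl inferInstance)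
  have hmem : ∀ n, μs n ∈ {μ : ProbabilityMeasure ℝ |
      ∀ k : ℕ, μ (Metric.closedBall (0 : ℝ) ((k : ℝ) + 1))ᶜ ≤ u k} := by
    intro n k
    have h1 := mul_meas_ge_le_integral_of_nonneg (ae_of_all _ fun x => sq_nonneg x) (hint n 2)
      ((k : ℝ) + 1)
    have h2 : (μs n : Measure ℝ).real (Metric.closedBall (0 : ℝ) ((k : ℝ) + 1))ᶜ
        ≤ (μs n : Measure ℝ).real {x | (k : ℝ) + 1 ≤ x ^ 2} := by
      refine measureReal_mono fun x hx => ?_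
      have hx' : (k : ℝ) + 1 < |x| := by simpa using hx
      have hk : (0 : ℝ) ≤ k := by positivity
      simp only [Set.mem_ofPred_eq]
      rw [← sq_abs]
      nlinarith
    have hk : (0 : ℝ) < (k : ℝ) + 1 := by positivity
    rw [← NNReal.coe_le_coe]
    change (μs n : Measure ℝ).real _ ≤ _
    simp only [u, NNReal.coe_mul, Real.coe_toNNReal _ hC0, NNReal.coe_inv, NNReal.coe_add,
      NNReal.coe_natCast, NNReal.coe_one]
    rw [← div_eq_mul_inv, le_div_iff₀ hk, mul_comm]
    exact (mul_le_mul_of_nonneg_left h2 hk.le).trans (h1.trans (hC n))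
  have hclus : ∀ D : ProbabilityMeasure ℝ, MapClusterPt D atTop μs → HasMoments (D : Measure ℝ) m := by
    intro D hD
    obtain ⟨U, hU, hUD⟩ := mapClusterPt_iff_ultrafilter.1 hD
    exact HasMoments.of_tendsto hUD hint fun r => (hlim r).mono_left hU
  obtain ⟨D, -, hD⟩ := hcomp.exists_mapClusterPt (f := atTop) (u := μs)
    (tendsto_principal.2 (Eventually.of_forall hmem))
  refine ⟨D, hclus D hD, hcomp.tendsto_nhds_of_unique_mapClusterPt (Eventually.of_forall hmem) ?_⟩
  intro D' _ hD'
  have := D.2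
  have := D'.2
  exact Subtype.ext ((hclus D' hD').unique (hclus D hD) hm)

/-! ### The power series attached to the urn -/

/-- The growth exponent of the sink degree. -/
noncomputable def growthExp : ℝ := √2 - 1

theorem growthExp_pos : 0 < growthExp := by
  have : (1 : ℝ) < √2 := by rw [Real.lt_sqrt] <;> norm_num
  unfold growthExp; linarith

theorem growthExp_sq : growthExp ^ 2 + 2 * growthExp = 1 := by
  unfold growthExp
  nlinarith [Real.sq_sqrt (show (0 : ℝ) ≤ 2 by norm_num)]

/-- The coefficients `c r` of the limit law. -/
noncomputable def limitCoeff : ℕ → ℝ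
  | 0 => 1
  | 1 => (1 + √2) / (2 * √2)
  | r + 2 => 1 / ((((r + 2 : ℕ) : ℝ) * growthExp + 1) ^ 2 - 2) *
      ∑ k : Fin (r + 1), limitCoeff (k + 1) * limitCoeff (r + 1 - k)

theorem limitCoeff_zero : limitCoeff 0 = 1 := by rw [limitCoeff]

theorem limitCoeff_one : limitCoeff 1 = (1 + √2) / (2 * √2) := by rw [limitCoeff]

theorem limitCoeff_one_pos : 0 < limitCoeff 1 := by rw [limitCoeff_one]; positivity

theorem limitCoeff_rec {r : ℕ} (hr : 2 ≤ r) :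
    limitCoeff r = 1 / (((r : ℝ) * growthExp + 1) ^ 2 - 2) *
      ∑ k ∈ Finset.Icc 1 (r - 1), limitCoeff k * limitCoeff (r - k) := by
  obtain ⟨m, rfl⟩ : ∃ m, r = m + 2 := ⟨r - 2, by omega⟩
  rw [limitCoeff, Fin.sum_univ_eq_sum_range (fun k => limitCoeff (k + 1) * limitCoeff (m + 1 - k))]
  congr 1
  have : Finset.Icc 1 (m + 2 - 1) = Finset.Ico 1 (m + 2) := by ext; simp; omega
  rw [this, Finset.sum_Ico_eq_sum_range]
  refine Finset.sum_congr rfl fun k hk => ?_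
  congr 2 <;> omega

/-- The lower bound is the number of summands in the recursion, which is what keeps the coefficients
at most `1`. -/
theorem denominator_ge {r : ℕ} (hr : 2 ≤ r) :
    (r : ℝ) - 1 ≤ ((r : ℝ) * growthExp + 1) ^ 2 - 2 := by
  have h : (2 : ℝ) ≤ r := by exact_mod_cast hr
  have h2 : ((r : ℝ) * growthExp + 1) ^ 2 - 2 - (r - 1)
      = growthExp ^ 2 * (r * (r - 1)) + (growthExp ^ 2 + 2 * growthExp - 1) * r := by ring
  rw [growthExp_sq, sub_self, zero_mul, add_zero] at h2
  have h3 : 0 ≤ growthExp ^ 2 * (r * ((r : ℝ) - 1)) :=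
    mul_nonneg (sq_nonneg _) (mul_nonneg (by linarith) (by linarith))
  linarith

theorem denominator_pos {r : ℕ} (hr : 2 ≤ r) : 0 < ((r : ℝ) * growthExp + 1) ^ 2 - 2 := by
  have h : (2 : ℝ) ≤ r := by exact_mod_cast hr
  linarith [denominator_ge hr]

theorem limitCoeff_mem_Icc (r : ℕ) : 0 ≤ limitCoeff r ∧ limitCoeff r ≤ 1 := by
  induction r using Nat.strong_induction_on with
  | _ r ih =>
    rcases Nat.lt_or_ge r 2 with hr | hr
    · interval_cases r
      · simp [limitCoeff_zero]
      · refine ⟨limitCoeff_one_pos.le, ?_⟩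
        have : (1 : ℝ) < √2 := by rw [Real.lt_sqrt] <;> norm_num
        rw [limitCoeff_one, div_le_one (by positivity)]
        linarith
    · have hmem : ∀ k ∈ Finset.Icc 1 (r - 1), k < r ∧ r - k < r := fun k hk => by
        rw [Finset.mem_Icc] at hk; omega
      have hd := denominator_pos hr
      rw [limitCoeff_rec hr]
      constructor
      · refine mul_nonneg (by positivity) (Finset.sum_nonneg fun k hk => ?_)
        exact mul_nonneg (ih _ (hmem k hk).1).1 (ih _ (hmem k hk).2).1
      · have hs : ∑ k ∈ Finset.Icc 1 (r - 1), limitCoeff k * limitCoeff (r - k) ≤ (r : ℝ) - 1 := by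
          refine (Finset.sum_le_card_nsmul _ _ 1 fun k hk => ?_).trans ?_
          · exact mul_le_one₀ (ih _ (hmem k hk).1).2 (ih _ (hmem k hk).2).1 (ih _ (hmem k hk).2).2
          · simp [Nat.cast_sub (show 1 ≤ r by omega)]
        rw [one_div, inv_mul_le_iff₀ hd, mul_one]
        exact hs.trans (denominator_ge hr)

/-- Moving the `-2` of the denominator across supplies the end terms `k = 0` and `k = r` of the
convolution. At `r = 1` it reduces to `(1 + g)² = 2`, whatever `c 1` is. In terms of series: `B² =
(1 + gθ)² B`. -/
theorem sum_antidiagonal_limitCoeff (r : ℕ) :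
    ∑ k ∈ Finset.HasAntidiagonal.antidiagonal r, limitCoeff k.1 * limitCoeff k.2
      = (1 + r * growthExp) ^ 2 * limitCoeff r := by
  rcases Nat.lt_or_ge r 2 with hr | hr
  · interval_cases r
    · simp [limitCoeff_zero]
    · rw [Finset.Nat.sum_antidiagonal_eq_sum_range_succ (fun a b => limitCoeff a * limitCoeff b)]
      simp [Finset.sum_range_succ, limitCoeff_zero]
      linear_combination (-(limitCoeff 1)) * growthExp_sq
  · have hd := denominator_pos hr
    have h := limitCoeff_rec hr
    rw [one_div, eq_inv_mul_iff_mul_eq₀ hd.ne'] at h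
    obtain ⟨m, rfl⟩ : ∃ m, r = m + 2 := ⟨r - 2, by omega⟩
    rw [Finset.Nat.sum_antidiagonal_eq_sum_range_succ (fun a b => limitCoeff a * limitCoeff b),
      Finset.sum_range_succ, Finset.sum_range_succ']
    have h2 : Finset.Icc 1 (m + 2 - 1) = Finset.Ico 1 (m + 2) := by ext; simp; omega
    rw [h2, Finset.sum_Ico_eq_sum_range] at h
    have h3 : ∑ k ∈ Finset.range (m + 1), limitCoeff (k + 1) * limitCoeff (m + 2 - (k + 1))
        = ∑ k ∈ Finset.range (m + 2 - 1), limitCoeff (1 + k) * limitCoeff (m + 2 - (1 + k)) :=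
      Finset.sum_congr rfl fun k _ => by rw [add_comm k 1]
    rw [h3, ← h, Nat.sub_zero, Nat.sub_self, limitCoeff_zero]
    ring

open PowerSeries

/-- The derivation `X d/dX` of power series. -/
noncomputable def euler : Derivation ℝ ℝ⟦X⟧ ℝ⟦X⟧ := (X : ℝ⟦X⟧) • PowerSeries.derivative ℝ

theorem coeff_euler (f : ℝ⟦X⟧) (r : ℕ) : coeff r (euler f) = r * coeff r f := by
  have h : euler f = X * PowerSeries.derivative ℝ f := rfl
  rw [h]
  cases r with
  | zero => simp
  | succ r => rw [coeff_succ_X_mul, coeff_derivative]; push_cast; ring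

/-- Generating series for an edge whose tail has out-degree different from `1`. -/
noncomputable def serSeries : ℝ⟦X⟧ := PowerSeries.mk limitCoeff

/-- Generating series for an edge whose tail has out-degree `1`. -/
noncomputable def parSeries : ℝ⟦X⟧ := PowerSeries.mk fun r => (1 + r * growthExp) * limitCoeff r

theorem smul_euler_parSeries :
    growthExp • euler parSeries = serSeries ^ 2 - parSeries := by
  ext r
  rw [coeff_smul, coeff_euler, map_sub, sq, coeff_mul]
  simp only [serSeries, parSeries, coeff_mk, sum_antidiagonal_limitCoeff, smul_eq_mul]
  ring

theorem smul_euler_serSeries : growthExp • euler serSeries = parSeries - serSeries := by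
  ext r
  rw [coeff_smul, coeff_euler, map_sub]
  simp only [serSeries, parSeries, coeff_mk, smul_eq_mul]
  ring

theorem euler_pow_mul_pow (A B : ℝ⟦X⟧) (p s : ℕ) :
    euler (A ^ p * B ^ s)
      = p * (A ^ (p - 1) * B ^ s * euler A) + s * (A ^ p * B ^ (s - 1) * euler B) := by
  rw [Derivation.leibniz, Derivation.leibniz_pow, Derivation.leibniz_pow]
  simp only [smul_eq_mul, nsmul_eq_mul]
  ring

/-- Leibniz and the two differential equations: `p A ^ (p - 1) B ^ s (B² - A)` is the parallel
transition, `s A ^ p B ^ (s - 1) (A - B)` the serial one. On coefficients `gθ` is multiplication by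
`r g`. -/
theorem urnGenerator_coeff (r p s : ℕ) :
    urnGenerator (fun p s => coeff r (parSeries ^ p * serSeries ^ s)) p s
      = r * growthExp * coeff r (parSeries ^ p * serSeries ^ s) := by
  have key : growthExp • euler (parSeries ^ p * serSeries ^ s)
      = p • (parSeries ^ (p - 1) * serSeries ^ (s + 2) - parSeries ^ p * serSeries ^ s)
        + s • (parSeries ^ (p + 1) * serSeries ^ (s - 1) - parSeries ^ p * serSeries ^ s) := by
    rw [euler_pow_mul_pow, smul_add, ← mul_smul_comm, ← mul_smul_comm, ← mul_smul_comm,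
      ← mul_smul_comm, smul_euler_parSeries, smul_euler_serSeries]
    simp only [nsmul_eq_mul]
    rcases p with - | p <;> rcases s with - | s <;>
      simp only [Nat.cast_zero, zero_mul, zero_add, add_zero, Nat.add_sub_cancel] <;> ring
  have h := congrArg (coeff r) key
  rw [coeff_smul, coeff_euler, map_add, map_nsmul, map_nsmul, map_sub, map_sub] at h
  rw [urnGenerator]
  simp only [nsmul_eq_mul, smul_eq_mul] at h
  rw [← h]
  ring

/-! ### Leading terms of the coefficients -/

section Recursion

variable {ι : Type*} {N : ι → ℝ} {f γ : ℕ → ι → ℝ}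

theorem isBigO_top_pow_of_le (hN : ∀ i, 1 ≤ N i) {a b : ℕ} (hab : a ≤ b) :
    (fun i => N i ^ a) =O[⊤] fun i => N i ^ b := by
  refine IsBigO.of_bound 1 (Eventually.of_forall fun i => ?_)
  have h0 : 0 ≤ N i := zero_le_one.trans (hN i)
  rw [Real.norm_of_nonneg (pow_nonneg h0 _), Real.norm_of_nonneg (pow_nonneg h0 _), one_mul]
  exact pow_le_pow_right₀ (hN i) hab

/-- Each factor `γ k` costs one power of `N` and lowers the index by at least one. The filter `⊤`
makes all bounds uniform in `i`. -/
theorem isBigO_pow_of_recursion (hN : ∀ i, 1 ≤ N i) (h0 : ∀ i, f 0 i = 1)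
    (hγ : ∀ k, γ k =O[⊤] N)
    (hf : ∀ (r : ℕ) i, ((r : ℝ) + 1) * f (r + 1) i = ∑ k ∈ Finset.range (r + 1), γ k i * f (r - k) i)
    (r : ℕ) : f r =O[⊤] fun i => N i ^ r := by
  induction r using Nat.strong_induction_on with
  | _ r ih =>
    cases r with
    | zero =>
      refine IsBigO.of_bound 1 (Eventually.of_forall fun i => ?_)
      simp [h0]
    | succ r =>
      have h1 : f (r + 1) = fun i => ((r : ℝ) + 1)⁻¹ *
          ∑ k ∈ Finset.range (r + 1), γ k i * f (r - k) i := by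
        ext i
        rw [← hf, inv_mul_cancel_left₀ (by positivity)]
      rw [h1]
      refine IsBigO.const_mul_left (IsBigO.fun_sum fun k _ => ?_) _
      have h2 := (hγ k).mul (ih (r - k) (by omega))
      refine h2.trans ?_
      simp_rw [← pow_succ']
      exact isBigO_top_pow_of_le hN (by omega)

/-- Only the term `k = 0` reaches the top order, and iterating it gives `γ 0 ^ r / r!`. The error is
multiplied by `N` to avoid an exponent `r - 1` at `r = 0`. -/
theorem isBigO_sub_leading_of_recursion (hN : ∀ i, 1 ≤ N i) (h0 : ∀ i, f 0 i = 1)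
    (hγ : ∀ k, γ k =O[⊤] N)
    (hf : ∀ (r : ℕ) i, ((r : ℝ) + 1) * f (r + 1) i = ∑ k ∈ Finset.range (r + 1), γ k i * f (r - k) i)
    (r : ℕ) : (fun i => (f r i - γ 0 i ^ r / r.factorial) * N i) =O[⊤] fun i => N i ^ r := by
  induction r with
  | zero =>
    refine IsBigO.of_bound 1 (Eventually.of_forall fun i => ?_)
    simp [h0]
  | succ r ih =>
    have h1 : (fun i => (f (r + 1) i - γ 0 i ^ (r + 1) / (r + 1).factorial) * N i)
        = fun i => ((r : ℝ) + 1)⁻¹ * (γ 0 i * ((f r i - γ 0 i ^ r / r.factorial) * N i)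
          + ∑ k ∈ Finset.range r, γ (k + 1) i * f (r - (k + 1)) i * N i) := by
      ext i
      have h2 := hf r i
      rw [Finset.sum_range_succ', Nat.sub_zero] at h2
      rw [← Finset.sum_mul, Nat.factorial_succ, eq_inv_mul_iff_mul_eq₀ (by positivity)]
      have h3 : (r.factorial : ℝ) ≠ 0 := by positivity
      have h4 : (r : ℝ) + 1 ≠ 0 := by positivity
      push_cast
      have h5 : ((r : ℝ) + 1) * (γ 0 i ^ (r + 1) / (((r : ℝ) + 1) * r.factorial))
          = γ 0 i * (γ 0 i ^ r / r.factorial) := by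
        field_simp
        ring
      linear_combination N i * h2 - N i * h5
    rw [h1]
    refine IsBigO.const_mul_left (IsBigO.add ?_ (IsBigO.fun_sum fun k hk => ?_)) _
    · simpa only [pow_succ'] using (hγ 0).mul ih
    · have hk := Finset.mem_range.1 hk
      have h2 := ((hγ (k + 1)).mul (isBigO_pow_of_recursion hN h0 hγ hf (r - (k + 1)))).mul
        (isBigO_refl N ⊤)
      refine h2.trans ?_
      simp_rw [← pow_succ', ← pow_succ]
      exact isBigO_top_pow_of_le hN (by omega)

end Recursion

/-- A power of a product of series with constant coefficient `1`: the coefficient of `X ^ r` is a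
polynomial in the exponents, with an explicit leading part. -/
theorem exists_abs_coeff_sub_le {A B : ℝ⟦X⟧} (hA : constantCoeff A = 1) (hB : constantCoeff B = 1)
    (r : ℕ) : ∃ C, ∀ p s : ℕ,
      |coeff r (A ^ p * B ^ s) - (coeff 1 A * p + coeff 1 B * s) ^ r / r.factorial|
        * (1 + p + s) ≤ C * (1 + p + s) ^ r := by
  -- The logarithmic derivative `θE / E` has no constant term, and its linear coefficient is that of
  -- `E`. For `F = A ^ p * B ^ s` this gives `θF = (p α + s β) F`, a recursion for the coefficients
  -- of `F` that is linear in `p` and `s`.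
  have hlog : ∀ E : ℝ⟦X⟧, constantCoeff E = 1 →
      E * (E⁻¹ * euler E) = euler E ∧ coeff 0 (E⁻¹ * euler E) = 0
        ∧ coeff 1 (E⁻¹ * euler E) = coeff 1 E := by
    intro E hE
    have h0 : E * (E⁻¹ * euler E) = euler E := by
      rw [← mul_assoc, PowerSeries.mul_inv_cancel E (by rw [hE]; exact one_ne_zero), one_mul]
    have h1 : coeff 0 (E⁻¹ * euler E) = 0 := by
      have h2 : constantCoeff (euler E) = 0 := by
        rw [← coeff_zero_eq_constantCoeff_apply, coeff_euler, Nat.cast_zero, zero_mul]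
      rw [coeff_zero_eq_constantCoeff_apply, map_mul, h2, mul_zero]
    refine ⟨h0, h1, ?_⟩
    have h2 := congrArg (coeff 1) h0
    rw [coeff_mul, coeff_euler, Finset.Nat.sum_antidiagonal_eq_sum_range_succ
      (fun a b => coeff a E * coeff b (E⁻¹ * euler E)), Finset.sum_range_succ,
      Finset.sum_range_one, Nat.sub_zero, Nat.sub_self, h1, mul_zero, add_zero,
      coeff_zero_eq_constantCoeff_apply, hE, one_mul, Nat.cast_one, one_mul] at h2
    exact h2
  obtain ⟨hA1, hA0, hA2⟩ := hlog A hA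
  obtain ⟨hB1, hB0, hB2⟩ := hlog B hB
  set α := A⁻¹ * euler A with hα
  set β := B⁻¹ * euler B with hβ
  have hN : ∀ i : ℕ × ℕ, (1 : ℝ) ≤ 1 + i.1 + i.2 := fun i => by
    have : (0 : ℝ) ≤ i.1 := by positivity
    have : (0 : ℝ) ≤ i.2 := by positivity
    linarith
  have key := isBigO_sub_leading_of_recursion (ι := ℕ × ℕ) (N := fun i => 1 + i.1 + i.2)
    (f := fun r i => coeff r (A ^ i.1 * B ^ i.2))
    (γ := fun k i => i.1 * coeff (k + 1) α + i.2 * coeff (k + 1) β) hN ?_ ?_ ?_ r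
  · obtain ⟨C, hC⟩ := isBigO_top.1 key
    refine ⟨C, fun p s => ?_⟩
    have h := hC (p, s)
    have h1 : (0 : ℝ) ≤ 1 + p + s := by positivity
    simp only [zero_add, hA2, hB2, norm_mul, norm_pow] at h
    rw [Real.norm_of_nonneg h1, Real.norm_eq_abs] at h
    rwa [mul_comm (coeff 1 A), mul_comm (coeff 1 B)]
  · intro i
    simp [hA, hB]
  · intro k
    refine IsBigO.of_bound (|coeff (k + 1) α| + |coeff (k + 1) β|) (Eventually.of_forall fun i => ?_)
    rw [Real.norm_eq_abs, Real.norm_of_nonneg (zero_le_one.trans (hN i))]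
    refine (abs_add_le _ _).trans ?_
    rw [abs_mul, abs_mul, Nat.abs_cast, Nat.abs_cast]
    have h1 : (0 : ℝ) ≤ i.1 := by positivity
    have h2 : (0 : ℝ) ≤ i.2 := by positivity
    nlinarith [abs_nonneg (coeff (k + 1) α), abs_nonneg (coeff (k + 1) β)]
  · rintro (r : ℕ) ⟨p, s⟩
    have h1 : euler (A ^ p * B ^ s) = (p • α + s • β) * (A ^ p * B ^ s) := by
      rw [euler_pow_mul_pow, ← hA1, ← hB1]
      simp only [nsmul_eq_mul]
      rcases p with - | p <;> rcases s with - | s <;>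
        simp only [Nat.cast_zero, zero_mul, zero_add, add_zero, Nat.add_sub_cancel] <;> ring
    have h2 := congrArg (coeff (r + 1)) h1
    rw [coeff_euler, coeff_mul _ (p • α + s • β), Finset.Nat.sum_antidiagonal_eq_sum_range_succ
      (fun a b => coeff a (p • α + s • β) * coeff b (A ^ p * B ^ s)), Finset.sum_range_succ'] at h2
    simp only [map_add, map_nsmul] at h2
    simp only [hA0, hB0, nsmul_eq_mul, mul_zero, add_zero, zero_mul, Nat.add_sub_add_right] at h2
    exact_mod_cast h2

/-! ### Growth of products and of the Gamma function -/

/-- The denominator of `Real.GammaSeq (μ + 1) n` runs from `μ + 1` to `μ + 1 + n`, two factors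
beyond the `n - 1` numerators of the product; hence the extra factors. -/
theorem prod_one_add_div_mul_GammaSeq {μ : ℝ} (hμ : 0 ≤ μ) {n : ℕ} (hn : 1 ≤ n) :
    (∏ k ∈ Finset.Ico 1 n, (1 + μ / k)) * ((μ + n) * (μ + 1 + n)) * Real.GammaSeq (μ + 1) n
      = (n : ℝ) ^ μ * n ^ 2 := by
  have h1 : ∀ n : ℕ, 1 ≤ n → ((n - 1).factorial : ℝ) * ∏ k ∈ Finset.Ico 1 n, (1 + μ / k)
      = ∏ j ∈ Finset.range (n - 1), (μ + 1 + j) := by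
    intro n hn
    induction n, hn using Nat.le_induction with
    | base => simp
    | succ n hn ih =>
      obtain ⟨m, rfl⟩ : ∃ m, n = m + 1 := ⟨n - 1, by omega⟩
      rw [Finset.prod_Ico_succ_top hn]
      simp only [Nat.add_sub_cancel] at ih ⊢
      rw [Finset.prod_range_succ, ← ih, Nat.factorial_succ]
      have : (m : ℝ) + 1 ≠ 0 := by positivity
      push_cast
      field_simp
      ring
  obtain ⟨m, rfl⟩ : ∃ m, n = m + 1 := ⟨n - 1, by omega⟩
  have h2 := h1 (m + 1) hn
  simp only [Nat.add_sub_cancel] at h2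
  rw [Real.GammaSeq, Finset.prod_range_succ, Finset.prod_range_succ, ← h2, Nat.factorial_succ,
    Real.rpow_add (by positivity), Real.rpow_one]
  have h3 : (∏ k ∈ Finset.Ico 1 (m + 1), (1 + μ / (k : ℝ))) ≠ 0 :=
    Finset.prod_ne_zero_iff.2 fun k _ => by positivity
  have h4 : (m.factorial : ℝ) ≠ 0 := by positivity
  have h5 : μ + 1 + m ≠ 0 := by positivity
  have h6 : μ + 1 + (m + 1) ≠ 0 := by positivity
  push_cast
  field_simp
  ring

theorem tendsto_prod_one_add_div {μ : ℝ} (hμ : 0 ≤ μ) :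
    Tendsto (fun n : ℕ => (∏ k ∈ Finset.Ico 1 n, (1 + μ / k)) / (n : ℝ) ^ μ) atTop
      (𝓝 (Real.Gamma (μ + 1))⁻¹) := by
  have hΓ : Real.Gamma (μ + 1) ≠ 0 := (Real.Gamma_pos_of_pos (by linarith)).ne'
  have h1 := (Real.GammaSeq_tendsto_Gamma (μ + 1)).inv₀ hΓ
  have h2 : ∀ a : ℝ, Tendsto (fun n : ℕ => (n : ℝ) / (n + a)) atTop (𝓝 1) := by
    intro a
    simpa using tendsto_natCast_div_add_atTop a
  have h3 := ((h2 μ).mul (h2 (μ + 1))).mul h1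
  simp only [mul_one, one_mul] at h3
  refine h3.congr' ?_
  filter_upwards [eventually_ge_atTop 1] with n hn
  have h4 := prod_one_add_div_mul_GammaSeq hμ hn
  have hn' : (0 : ℝ) < n := by exact_mod_cast hn
  have h5 : (0 : ℝ) < (n : ℝ) ^ μ := Real.rpow_pos_of_pos hn' _
  have h6 : Real.GammaSeq (μ + 1) n ≠ 0 := by
    intro h0
    rw [h0, mul_zero] at h4
    have : (0 : ℝ) < (n : ℝ) ^ μ * n ^ 2 := by positivity
    linarith
  have h7 : (n : ℝ) + μ ≠ 0 := by positivity
  have h8 : (n : ℝ) + (μ + 1) ≠ 0 := by positivity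
  rw [eq_div_iff h5.ne']
  field_simp
  linear_combination -h4

/-- Keep only the part `t > K` of Euler's integral, where `t ^ x ≥ K ^ x`. As `K` is arbitrary,
Gamma outgrows every exponential. -/
theorem rpow_mul_exp_neg_le_Gamma {K x : ℝ} (hK : 0 < K) (hx : 0 ≤ x) :
    K ^ x * Real.exp (-K) ≤ Real.Gamma (x + 1) := by
  rw [Real.Gamma_eq_integral (by linarith), add_sub_cancel_right]
  have hint : IntegrableOn (fun t : ℝ => Real.exp (-t) * t ^ x) (Set.Ioi 0) := by
    simpa using Real.GammaIntegral_convergent (s := x + 1) (by linarith)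
  calc K ^ x * Real.exp (-K) = ∫ t in Set.Ioi K, K ^ x * Real.exp (-t) := by
        rw [integral_const_mul, integral_exp_neg_Ioi]
    _ ≤ ∫ t in Set.Ioi K, Real.exp (-t) * t ^ x := by
        refine setIntegral_mono_on ((integrableOn_exp_neg_Ioi K).const_mul _)
          (hint.mono_set (Set.Ioi_subset_Ioi hK.le)) measurableSet_Ioi fun t ht => ?_
        rw [mul_comm]
        gcongr
        exact (Set.mem_Ioi.1 ht).le
    _ ≤ ∫ t in Set.Ioi 0, Real.exp (-t) * t ^ x := by
        refine setIntegral_mono_set hint ?_ (Set.Ioi_subset_Ioi hK.le).eventuallyLE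
        filter_upwards [ae_restrict_mem measurableSet_Ioi] with t ht
        have : (0 : ℝ) < t := ht
        positivity

/-- The moments of the limit law. -/
noncomputable def limitMoment (r : ℕ) : ℝ :=
  (r.factorial : ℝ) * ((r : ℝ) * growthExp + 1) * limitCoeff r / Real.Gamma ((r : ℝ) * growthExp + 1)

theorem tendsto_pow_mul_limitMoment (t : ℝ) :
    Tendsto (fun r : ℕ => t ^ r * limitMoment r / r.factorial) atTop (𝓝 0) := by
  -- Chosen so that `K ^ (r g) = (2 (|t| + 1)) ^ r`, which beats `|t| ^ r` by a factor `2 ^ r`.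
  set K : ℝ := (2 * (|t| + 1)) ^ growthExp⁻¹ with hKdef
  have hK : 0 < K := by positivity
  have hKr : ∀ r : ℕ, K ^ ((r : ℝ) * growthExp) = (2 * (|t| + 1)) ^ r := by
    intro r
    rw [hKdef, ← Real.rpow_mul (by positivity), mul_comm (r : ℝ), ← mul_assoc,
      inv_mul_cancel₀ growthExp_pos.ne', one_mul, Real.rpow_natCast]
  have hlim : Tendsto (fun r : ℕ => Real.exp K * (((r : ℝ) * (1 / 2) ^ r) * growthExp
      + (1 / 2) ^ r)) atTop (𝓝 0) := by
    have h1 := tendsto_self_mul_const_pow_of_lt_one (r := (1 / 2 : ℝ)) (by norm_num) (by norm_num)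
    have h2 := tendsto_pow_atTop_nhds_zero_of_lt_one (r := (1 / 2 : ℝ)) (by norm_num) (by norm_num)
    simpa using ((h1.mul_const growthExp).add h2).const_mul (Real.exp K)
  refine squeeze_zero_norm (fun r => ?_) hlim
  have hx : 0 ≤ (r : ℝ) * growthExp := mul_nonneg (by positivity) growthExp_pos.le
  have hΓ := rpow_mul_exp_neg_le_Gamma hK hx
  rw [hKr] at hΓ
  have hc := limitCoeff_mem_Icc r
  have hΓ0 : 0 < Real.Gamma ((r : ℝ) * growthExp + 1) := Real.Gamma_pos_of_pos (by linarith)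
  have h1 : t ^ r * limitMoment r / r.factorial
      = t ^ r * (((r : ℝ) * growthExp + 1) * limitCoeff r)
        / Real.Gamma ((r : ℝ) * growthExp + 1) := by
    have : (r.factorial : ℝ) ≠ 0 := by positivity
    rw [limitMoment]
    field_simp
  rw [h1, Real.norm_eq_abs, abs_div, abs_mul, abs_pow, abs_of_pos hΓ0,
    abs_of_nonneg (mul_nonneg (by linarith) hc.1), div_le_iff₀ hΓ0]
  have h2 : |t| ^ r ≤ (|t| + 1) ^ r := by gcongr; linarith
  have h3 : ((1 : ℝ) / 2) ^ r * (2 * (|t| + 1)) ^ r = (|t| + 1) ^ r := by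
    rw [← mul_pow]; congr 1; ring
  calc |t| ^ r * (((r : ℝ) * growthExp + 1) * limitCoeff r)
      ≤ (|t| + 1) ^ r * (((r : ℝ) * growthExp + 1) * 1) := by
        gcongr
        · exact mul_nonneg (by linarith) hc.1
        · exact hc.2
    _ = Real.exp K * (((r : ℝ) * (1 / 2) ^ r) * growthExp + (1 / 2) ^ r)
        * ((2 * (|t| + 1)) ^ r * Real.exp (-K)) := by
        rw [← h3, Real.exp_neg]
        field_simp
    _ ≤ _ := by
        refine mul_le_mul_of_nonneg_left hΓ ?_
        have := growthExp_pos
        positivity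

/-! ### Moments of the urn -/

/-- The linear statistic of the urn with the largest eigenvalue, normalized like the degree. -/
noncomputable def leadingStat (p s : ℕ) : ℝ := (1 + √2) / 2 * p + (1 + √2) / (2 * √2) * s

/-- The linear statistic of the urn with the negative eigenvalue. -/
noncomputable def deviation (p s : ℕ) : ℝ := √2 * p - s

theorem degree_eq (p s : ℕ) :
    (p : ℝ) + s = leadingStat p s - (√2 - 1) / (2 * √2) * deviation p s := by
  have h0 : √2 ≠ 0 := by positivity
  unfold leadingStat deviation
  field_simp
  ring

theorem urnGenerator_linear (u v : ℝ) (p s : ℕ) :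
    urnGenerator (fun p s => u * p + v * s) p s = p * (2 * v - u) + s * (u - v) := by
  unfold urnGenerator
  rcases p with - | p <;> rcases s with - | s <;> push_cast [Nat.add_sub_cancel] <;> ring

theorem urnGenerator_leadingStat (p s : ℕ) :
    urnGenerator leadingStat p s = growthExp * leadingStat p s := by
  have h : √2 ^ 2 = 2 := Real.sq_sqrt (by norm_num)
  have h0 : √2 ≠ 0 := by positivity
  have h1 := urnGenerator_linear ((1 + √2) / 2) ((1 + √2) / (2 * √2)) p s
  change urnGenerator leadingStat p s = _ at h1
  rw [h1, leadingStat, growthExp]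
  field_simp
  linear_combination -(p : ℝ) * h

theorem urnGenerator_deviation (p s : ℕ) :
    urnGenerator deviation p s = (-1 - √2) * deviation p s := by
  have h : √2 ^ 2 = 2 := Real.sq_sqrt (by norm_num)
  have h1 := urnGenerator_linear √2 (-1) p s
  have h2 : (fun p s : ℕ => √2 * p + -1 * (s : ℝ)) = deviation := by
    ext p s; rw [deviation]; ring
  rw [h2] at h1
  rw [h1, deviation]
  linear_combination (p : ℝ) * h

theorem urnMean_degree {n : ℕ} (hn : 1 ≤ n) :
    urnMean n (fun p s => (p : ℝ) + s)
      = (1 + √2) / 2 * (∏ k ∈ Finset.Ico 1 n, (1 + (√2 - 1) / (k : ℝ)))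
        - (√2 - 1) / 2 * ∏ k ∈ Finset.Ico 1 n, (1 + (-√2 - 1) / (k : ℝ)) := by
  have h0 : √2 ≠ 0 := by positivity
  simp_rw [degree_eq]
  have h1 : urnMean n leadingStat = _ := urnMean_eigen urnGenerator_leadingStat hn
  have h2 : urnMean n deviation = _ := urnMean_eigen urnGenerator_deviation hn
  rw [urnMean_sub, urnMean_const_mul, h1, h2, growthExp, leadingStat, deviation, show -1 - √2 = -√2 - 1 by ring]
  push_cast
  field_simp
  ring

/-- The binomial is `Ring.multichoose r (n - 1)`, a rising factorial of `r` over `(n - 1)!`. -/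
theorem choose_eq_prod (r : ℝ) {n : ℕ} (hn : 1 ≤ n) :
    Ring.choose ((n : ℝ) + r - 2) (n - 1) = ∏ k ∈ Finset.Ico 1 n, (1 + (r - 1) / (k : ℝ)) := by
  obtain ⟨m, rfl⟩ : ∃ m, n = m + 1 := ⟨n - 1, by omega⟩
  have h1 : ((m + 1 : ℕ) : ℝ) + r - 2 = r + m - 1 := by push_cast; ring
  rw [h1, Nat.add_sub_cancel, ← Ring.multichoose_eq]
  have h2 := Ring.factorial_nsmul_multichoose_eq_ascPochhammer r m
  rw [Polynomial.ascPochhammer_smeval_eq_eval, nsmul_eq_mul] at h2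
  have h3 : (m.factorial : ℝ) ≠ 0 := by positivity
  refine mul_left_cancel₀ h3 (h2.trans ?_)
  clear h1 h2 h3 hn
  induction m with
  | zero => simp
  | succ m ih =>
    rw [ascPochhammer_succ_eval, ih, Finset.prod_Ico_succ_top (show 1 ≤ m + 1 by omega), Nat.factorial_succ]
    have : (m : ℝ) + 1 ≠ 0 := by positivity
    push_cast
    field_simp
    ring

/-! ### Eigenfunctions of higher degree and asymptotics of all moments -/

theorem coeff_one_parSeries : PowerSeries.coeff 1 parSeries = (1 + √2) / 2 := by
  have h0 : √2 ≠ 0 := by positivity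
  rw [parSeries, PowerSeries.coeff_mk, limitCoeff_one, growthExp]
  push_cast
  field_simp
  ring

theorem coeff_one_serSeries : PowerSeries.coeff 1 serSeries = (1 + √2) / (2 * √2) := by
  rw [serSeries, PowerSeries.coeff_mk, limitCoeff_one]

theorem constantCoeff_parSeries : PowerSeries.constantCoeff parSeries = 1 := by
  rw [← PowerSeries.coeff_zero_eq_constantCoeff_apply, parSeries, PowerSeries.coeff_mk,
    limitCoeff_zero]
  simp

theorem constantCoeff_serSeries : PowerSeries.constantCoeff serSeries = 1 := by
  rw [← PowerSeries.coeff_zero_eq_constantCoeff_apply, serSeries, PowerSeries.coeff_mk,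
    limitCoeff_zero]

/-- The statistic of the urn that is an eigenfunction of degree `r`. -/
noncomputable def eigenStat (r p s : ℕ) : ℝ := PowerSeries.coeff r (parSeries ^ p * serSeries ^ s)

theorem exists_abs_eigenStat_sub_le (r : ℕ) : ∃ C, 0 ≤ C ∧ ∀ p s : ℕ,
    |eigenStat (r + 1) p s - leadingStat p s ^ (r + 1) / (r + 1).factorial|
      ≤ C * (1 + p + s) ^ r := by
  obtain ⟨C, hC⟩ := exists_abs_coeff_sub_le constantCoeff_parSeries constantCoeff_serSeries (r + 1)
  refine ⟨|C|, abs_nonneg C, fun p s => ?_⟩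
  have h := hC p s
  have h1 : (0 : ℝ) < 1 + p + s := by positivity
  rw [pow_succ (1 + (p : ℝ) + s) r, ← mul_assoc, coeff_one_parSeries, coeff_one_serSeries] at h
  refine (le_of_mul_le_mul_right h h1).trans ?_
  gcongr
  exact le_abs_self C

theorem tendsto_urnMean_eigenStat (r : ℕ) :
    Tendsto (fun n : ℕ => urnMean n (eigenStat r) / (n : ℝ) ^ ((r : ℝ) * growthExp)) atTop
      (𝓝 (((r : ℝ) * growthExp + 1) * limitCoeff r / Real.Gamma ((r : ℝ) * growthExp + 1))) := by
  have hx : 0 ≤ (r : ℝ) * growthExp := mul_nonneg (by positivity) growthExp_pos.le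
  have h := (tendsto_prod_one_add_div hx).mul_const (((r : ℝ) * growthExp + 1) * limitCoeff r)
  rw [inv_mul_eq_div] at h
  refine h.congr' ?_
  filter_upwards [eventually_ge_atTop 1] with n hn
  have h2 : urnMean n (eigenStat r) = _ := urnMean_eigen (urnGenerator_coeff r) hn
  rw [h2, pow_one, pow_zero, mul_one, parSeries,
    PowerSeries.coeff_mk, add_comm (1 : ℝ)]
  ring

theorem exists_urnMean_eigenStat_le (r : ℕ) : ∃ C, 0 ≤ C ∧ ∀ n : ℕ, 1 ≤ n →
    urnMean n (eigenStat r) ≤ C * (n : ℝ) ^ ((r : ℝ) * growthExp) := by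
  obtain ⟨C, hC⟩ := (tendsto_urnMean_eigenStat r).bddAbove_range
  refine ⟨|C|, abs_nonneg C, fun n hn => ?_⟩
  have hn' : (0 : ℝ) < n := by exact_mod_cast hn
  rw [← div_le_iff₀ (Real.rpow_pos_of_pos hn' _)]
  exact (hC ⟨n, rfl⟩).trans (le_abs_self C)

theorem one_lt_sqrt_two : (1 : ℝ) < √2 := by rw [Real.lt_sqrt] <;> norm_num

theorem sqrt_two_lt_two : √2 < 2 := by rw [Real.sqrt_lt'] <;> norm_num

theorem degree_le_leadingStat (p s : ℕ) : (p : ℝ) + s ≤ 2 * leadingStat p s := by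
  have h2 := one_lt_sqrt_two
  have h3 := sqrt_two_lt_two
  have h4 : (1 : ℝ) / 2 ≤ (1 + √2) / (2 * √2) := by
    rw [div_le_div_iff₀ (by norm_num) (by positivity)]; linarith
  have h5 : (0 : ℝ) ≤ p := by positivity
  have h6 : (0 : ℝ) ≤ s := by positivity
  unfold leadingStat
  nlinarith

theorem leadingStat_nonneg (p s : ℕ) : 0 ≤ leadingStat p s := by
  unfold leadingStat; positivity

theorem leadingStat_le (p s : ℕ) : leadingStat p s ≤ 2 * (1 + p + s) := by
  have h2 := one_lt_sqrt_two
  have h3 := sqrt_two_lt_two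
  have h4 : (1 + √2) / (2 * √2) ≤ 1 := by
    rw [div_le_one (by positivity)]; linarith
  have h5 : (0 : ℝ) ≤ p := by positivity
  have h6 : (0 : ℝ) ≤ s := by positivity
  unfold leadingStat
  nlinarith

/-- Induction on the degree: the size is comparable to `leadingStat`, whose top power is an
eigenfunction, with known mean, up to an error of lower degree. -/
theorem exists_urnMean_size_pow_le (r : ℕ) : ∃ C, 0 ≤ C ∧ ∀ n : ℕ, 1 ≤ n →
    urnMean n (fun p s => (1 + (p : ℝ) + s) ^ r) ≤ C * (n : ℝ) ^ ((r : ℝ) * growthExp) := by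
  induction r with
  | zero =>
    refine ⟨1, zero_le_one, fun n _ => ?_⟩
    simp [urnMean_const]
  | succ r ih =>
    obtain ⟨C₁, hC₁, h₁⟩ := ih
    obtain ⟨C₂, hC₂, h₂⟩ := exists_urnMean_eigenStat_le (r + 1)
    obtain ⟨C₃, hC₃, h₃⟩ := exists_abs_eigenStat_sub_le r
    obtain ⟨K, hK⟩ : ∃ K : ℝ, K = 2 ^ (r + 1) * (r + 1).factorial := ⟨_, rfl⟩
    have hK0 : 0 ≤ K := by rw [hK]; positivity
    refine ⟨2 ^ r * (1 + K * (C₂ + C₃ * C₁)), by positivity, fun n hn => ?_⟩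
    have hpt : ∀ p s : ℕ, (1 + (p : ℝ) + s) ^ (r + 1)
        ≤ 2 ^ r * (1 + K * (eigenStat (r + 1) p s + C₃ * (1 + (p : ℝ) + s) ^ r)) := by
      intro p s
      have h4 : (1 + (p : ℝ) + s) ^ (r + 1) ≤ 2 ^ r * (1 + ((p : ℝ) + s) ^ (r + 1)) := by
        have := add_pow_le (zero_le_one (α := ℝ)) (show (0 : ℝ) ≤ (p : ℝ) + s by positivity) (r + 1)
        simpa [add_assoc] using this
      have h5 : ((p : ℝ) + s) ^ (r + 1) ≤ (2 * leadingStat p s) ^ (r + 1) :=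
        pow_le_pow_left₀ (by positivity) (degree_le_leadingStat p s) _
      have h6 := neg_le_of_abs_le (h₃ p s)
      have h7 : leadingStat p s ^ (r + 1) ≤ (r + 1).factorial *
          (eigenStat (r + 1) p s + C₃ * (1 + (p : ℝ) + s) ^ r) := by
        rw [← div_le_iff₀' (by positivity)]
        linarith
      refine h4.trans ?_
      gcongr
      refine h5.trans ?_
      rw [mul_pow, hK, mul_assoc]
      gcongr
    have hmean := urnMean_mono n hpt
    rw [urnMean_const_mul, urnMean_add, urnMean_const, urnMean_const_mul, urnMean_add,
      urnMean_const_mul] at hmean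
    refine hmean.trans ?_
    have hn' : (1 : ℝ) ≤ n := by exact_mod_cast hn
    have hg := growthExp_pos
    set Y := (n : ℝ) ^ (((r + 1 : ℕ) : ℝ) * growthExp) with hY
    have h8 : 1 ≤ Y := Real.one_le_rpow hn' (by positivity)
    have h9 : (n : ℝ) ^ ((r : ℝ) * growthExp) ≤ Y := by
      refine Real.rpow_le_rpow_of_exponent_le hn' ?_
      gcongr
      simp
    have h10 : C₃ * urnMean n (fun p s => (1 + (p : ℝ) + s) ^ r) ≤ C₃ * (C₁ * Y) := by
      gcongr
      exact (h₁ n hn).trans (by gcongr)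
    have h11 : K * (urnMean n (eigenStat (r + 1)) + C₃ * urnMean n (fun p s => (1 + (p : ℝ) + s) ^ r))
        ≤ K * (C₂ * Y + C₃ * (C₁ * Y)) := by
      have := h₂ n hn
      gcongr
    have h12 : 1 + K * (urnMean n (eigenStat (r + 1))
        + C₃ * urnMean n (fun p s => (1 + (p : ℝ) + s) ^ r))
        ≤ (1 + K * (C₂ + C₃ * C₁)) * Y := by
      nlinarith
    calc _ ≤ _ := mul_le_mul_of_nonneg_left h12 (by positivity)
      _ = _ := by ring

theorem tendsto_div_rpow_zero_of_le {y : ℕ → ℝ} {C α β : ℝ} (hαβ : α < β)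
    (hy : ∀ n : ℕ, 1 ≤ n → |y n| ≤ C * (n : ℝ) ^ α) :
    Tendsto (fun n : ℕ => y n / (n : ℝ) ^ β) atTop (𝓝 0) := by
  have h1 : Tendsto (fun n : ℕ => C * (n : ℝ) ^ (-(β - α))) atTop (𝓝 0) := by
    simpa using ((tendsto_rpow_neg_atTop (sub_pos.2 hαβ)).comp tendsto_natCast_atTop_atTop).const_mul C
  refine squeeze_zero_norm' ?_ h1
  filter_upwards [eventually_ge_atTop 1] with n hn
  have hn' : (0 : ℝ) < n := by exact_mod_cast hn
  rw [norm_div, Real.norm_eq_abs, Real.norm_of_nonneg (by positivity),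
    div_le_iff₀ (Real.rpow_pos_of_pos hn' _), mul_assoc, ← Real.rpow_add hn']
  rw [show -(β - α) + β = α by ring]
  exact hy n hn

theorem tendsto_urnMean_leadingStat_pow (r : ℕ) :
    Tendsto (fun n : ℕ => urnMean n (fun p s => leadingStat p s ^ r)
      / (n : ℝ) ^ ((r : ℝ) * growthExp)) atTop (𝓝 (limitMoment r)) := by
  cases r with
  | zero =>
    simp [urnMean_const, limitMoment, limitCoeff_zero]
  | succ r =>
    obtain ⟨C₁, hC₁, h₁⟩ := exists_urnMean_size_pow_le r
    obtain ⟨C₃, hC₃, h₃⟩ := exists_abs_eigenStat_sub_le r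
    have hlt : (r : ℝ) * growthExp < ((r + 1 : ℕ) : ℝ) * growthExp := by
      have := growthExp_pos
      gcongr
      simp
    have h2 := tendsto_div_rpow_zero_of_le (C := C₃ * C₁) hlt (y := fun n => urnMean n (fun p s =>
      eigenStat (r + 1) p s - leadingStat p s ^ (r + 1) / (r + 1).factorial)) (fun n hn => by
        refine (abs_urnMean_le n _).trans ((urnMean_mono n h₃).trans ?_)
        rw [urnMean_const_mul, mul_assoc]
        exact mul_le_mul_of_nonneg_left (h₁ n hn) hC₃)
    have h3 := ((tendsto_urnMean_eigenStat (r + 1)).sub h2).const_mul ((r + 1).factorial : ℝ)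
    rw [sub_zero] at h3
    have h4 : limitMoment (r + 1) = ((r + 1).factorial : ℝ) * ((((r + 1 : ℕ) : ℝ) * growthExp + 1)
        * limitCoeff (r + 1) / Real.Gamma (((r + 1 : ℕ) : ℝ) * growthExp + 1)) := by
      rw [limitMoment]; ring
    rw [h4]
    refine h3.congr fun n => ?_
    have h5 : urnMean n (fun p s => eigenStat (r + 1) p s
        - leadingStat p s ^ (r + 1) / (r + 1).factorial)
        = urnMean n (eigenStat (r + 1)) - ((r + 1).factorial : ℝ)⁻¹
          * urnMean n (fun p s => leadingStat p s ^ (r + 1)) := by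
      rw [← urnMean_const_mul, ← urnMean_sub]
      simp_rw [div_eq_inv_mul]
    have h6 : ((r + 1).factorial : ℝ) ≠ 0 := by positivity
    rw [h5, ← sub_div, sub_sub_cancel, mul_div_assoc, mul_inv_cancel_left₀ h6]

/-- The square has twice the eigenvalue, `2 (-1 - √2) ≤ -4`, plus the squared jumps `(√2 + 2)²` and
`(√2 + 1)²` weighted by `p` and `s`; both are below `12`. -/
theorem urnGenerator_deviation_sq_le (p s : ℕ) :
    urnGenerator (fun p s => deviation p s ^ 2) p s
      ≤ -4 * deviation p s ^ 2 + 12 * (1 + p + s) := by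
  have h : √2 ^ 2 = 2 := Real.sq_sqrt (by norm_num)
  have h2 := one_lt_sqrt_two
  have h3 : √2 < 1.42 := by rw [Real.sqrt_lt'] <;> norm_num
  have h1 : urnGenerator (fun p s => deviation p s ^ 2) p s
      = 2 * (-1 - √2) * deviation p s ^ 2 + (√2 + 2) ^ 2 * p + (√2 + 1) ^ 2 * s := by
    unfold urnGenerator deviation
    rcases p with - | p <;> rcases s with - | s <;> push_cast [Nat.add_sub_cancel]
    · ring
    · ring
    · linear_combination 2 * ((p : ℝ) + 1) * (√2 * (p + 1)) * h
    · linear_combination 2 * ((p : ℝ) + 1) * (√2 * (p + 1) - (s + 1)) * h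
  have h5 : (0 : ℝ) ≤ p := by positivity
  have h6 : (0 : ℝ) ≤ s := by positivity
  rw [h1]
  nlinarith [sq_nonneg (deviation p s), mul_nonneg h5 (sub_nonneg.2 h3.le),
    mul_nonneg h6 (sub_nonneg.2 h3.le)]

theorem exists_urnMean_deviation_sq_le : ∃ C, 0 ≤ C ∧ ∀ n : ℕ, 1 ≤ n →
    urnMean n (fun p s => deviation p s ^ 2) ≤ C * (n : ℝ) ^ growthExp := by
  obtain ⟨C, hC, h⟩ := exists_urnMean_size_pow_le 1
  -- The `2` is the initial value `deviation 1 0 ^ 2`; the `12 * C` absorbs the forcing by the size.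
  refine ⟨12 * C + 2, by positivity, fun n hn => ?_⟩
  induction n, hn using Nat.le_induction with
  | base =>
    rw [urnMean_one, deviation]
    have : √2 ^ 2 = 2 := Real.sq_sqrt (by norm_num)
    simp [this, hC]
  | succ n hn ih =>
    have hn' : (1 : ℝ) ≤ n := by exact_mod_cast hn
    have hn0 : (0 : ℝ) < n := by linarith
    rw [urnMean_succ hn]
    set E := urnMean n (fun p s => deviation p s ^ 2) with hE
    have hE0 : 0 ≤ E := urnMean_nonneg n fun p s => sq_nonneg _
    set Y := (n : ℝ) ^ growthExp with hY
    have hYpos : 0 < Y := Real.rpow_pos_of_pos hn0 _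
    have hsize := h n hn
    simp only [pow_one, Nat.cast_one, one_mul] at hsize
    have hYsucc : Y ≤ ((n + 1 : ℕ) : ℝ) ^ growthExp := by
      refine Real.rpow_le_rpow hn0.le ?_ growthExp_pos.le
      push_cast; linarith
    have h1 : urnMean n (fun p s => deviation p s ^ 2
        + (n : ℝ)⁻¹ * urnGenerator (fun p s => deviation p s ^ 2) p s)
        ≤ E + (n : ℝ)⁻¹ * (-4 * E + 12 * (C * Y)) := by
      rw [urnMean_add, urnMean_const_mul]
      gcongr
      refine (urnMean_mono n urnGenerator_deviation_sq_le).trans ?_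
      rw [urnMean_add, urnMean_const_mul, urnMean_const_mul]
      gcongr
    refine h1.trans (le_trans ?_ (mul_le_mul_of_nonneg_left hYsucc (by positivity)))
    have hi : 0 < (n : ℝ)⁻¹ := by positivity
    have hi1 : (n : ℝ)⁻¹ ≤ 1 := inv_le_one_of_one_le₀ hn'
    have hCY : 0 ≤ C * Y := by positivity
    -- For small `n` the factor `1 - 4 / n` may be negative; then the term with `E` is dropped
    -- instead of being bounded by induction.
    rcases le_total (4 * (n : ℝ)⁻¹) 1 with h4 | h4
    · nlinarith [mul_le_mul_of_nonneg_left ih (sub_nonneg.2 h4), mul_nonneg hi.le hCY,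
        mul_nonneg hi.le hYpos.le]
    · nlinarith [mul_nonneg hE0 (sub_nonneg.2 h4), mul_nonneg (sub_nonneg.2 hi1) hCY]

theorem tendsto_urnMean_degree_pow (r : ℕ) :
    Tendsto (fun n : ℕ => urnMean n (fun p s => ((p : ℝ) + s) ^ r)
      / (n : ℝ) ^ ((r : ℝ) * growthExp)) atTop (𝓝 (limitMoment r)) := by
  cases r with
  | zero =>
    simp [urnMean_const, limitMoment, limitCoeff_zero]
  | succ r =>
    obtain ⟨C₁, hC₁, h₁⟩ := exists_urnMean_size_pow_le (2 * r)
    obtain ⟨C₂, hC₂, h₂⟩ := exists_urnMean_deviation_sq_le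
    have hg := growthExp_pos
    obtain ⟨K, hK⟩ : ∃ K : ℝ, K = ((r + 1 : ℕ) : ℝ) * 2 ^ r := ⟨_, rfl⟩
    have hK0 : 0 ≤ K := by rw [hK]; positivity
    have hpt : ∀ p s : ℕ, |((p : ℝ) + s) ^ (r + 1) - leadingStat p s ^ (r + 1)|
        ≤ K * (|deviation p s| * (1 + (p : ℝ) + s) ^ r) := by
      intro p s
      have hN : (0 : ℝ) ≤ 1 + p + s := by positivity
      have h3 := abs_pow_sub_pow_le ((p : ℝ) + s) (leadingStat p s) (r + 1)
      have h4 : |(p : ℝ) + s - leadingStat p s| ≤ |deviation p s| := by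
        have hk : |(√2 - 1) / (2 * √2)| ≤ 1 := by
          have := one_lt_sqrt_two
          rw [abs_of_nonneg (div_nonneg (by linarith) (by positivity)), div_le_one (by positivity)]
          linarith
        rw [degree_eq, sub_sub_cancel_left, abs_neg, abs_mul]
        exact mul_le_of_le_one_left (abs_nonneg _) hk
      have h5 : max |(p : ℝ) + s| |leadingStat p s| ≤ 2 * (1 + p + s) := by
        rw [abs_of_nonneg (by positivity), abs_of_nonneg (leadingStat_nonneg p s)]
        exact max_le (by linarith) (leadingStat_le p s)
      calc _ ≤ _ := h3
        _ ≤ |deviation p s| * ((r + 1 : ℕ) : ℝ) * (2 * (1 + (p : ℝ) + s)) ^ r := by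
          rw [Nat.add_sub_cancel]
          gcongr
        _ = _ := by rw [mul_pow, hK]; ring
    have hlt : ((r : ℝ) + 1 / 2) * growthExp < ((r + 1 : ℕ) : ℝ) * growthExp := by
      gcongr
      push_cast
      linarith
    have h3 := tendsto_div_rpow_zero_of_le (C := K * ((C₂ + C₁) / 2)) hlt
      (y := fun n => urnMean n (fun p s => ((p : ℝ) + s) ^ (r + 1) - leadingStat p s ^ (r + 1)))
      (fun n hn => by
        refine (abs_urnMean_le n _).trans ((urnMean_mono n hpt).trans ?_)
        rw [urnMean_const_mul, mul_assoc]
        refine mul_le_mul_of_nonneg_left ?_ hK0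
        have hn0 : (0 : ℝ) < n := by exact_mod_cast hn
        -- The weight in the inequality between arithmetic and geometric means that gives both terms
        -- the order `n ^ ((r + 1/2) g)`, which is below `n ^ ((r + 1) g)`.
        set t := (n : ℝ) ^ (((r : ℝ) - 1 / 2) * growthExp) with ht
        have ht0 : 0 < t := Real.rpow_pos_of_pos hn0 _
        have hamgm : ∀ p s : ℕ, |deviation p s| * (1 + (p : ℝ) + s) ^ r
            ≤ t / 2 * deviation p s ^ 2 + t⁻¹ / 2 * (1 + (p : ℝ) + s) ^ (2 * r) := by
          intro p s
          rw [pow_mul', ← sq_abs (deviation p s)]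
          set a := |deviation p s|
          set b := (1 + (p : ℝ) + s) ^ r
          have : t / 2 * a ^ 2 + t⁻¹ / 2 * b ^ 2 - a * b = t⁻¹ / 2 * (t * a - b) ^ 2 := by
            field_simp; ring
          have : 0 ≤ t⁻¹ / 2 * (t * a - b) ^ 2 := by positivity
          linarith
        refine (urnMean_mono n hamgm).trans ?_
        rw [urnMean_add, urnMean_const_mul, urnMean_const_mul]
        have h4 : t * (n : ℝ) ^ growthExp = (n : ℝ) ^ (((r : ℝ) + 1 / 2) * growthExp) := by
          rw [ht, ← Real.rpow_add hn0]; congr 1; ring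
        have h5 : t⁻¹ * (n : ℝ) ^ (((2 * r : ℕ) : ℝ) * growthExp)
            = (n : ℝ) ^ (((r : ℝ) + 1 / 2) * growthExp) := by
          rw [ht, ← Real.rpow_neg hn0.le, ← Real.rpow_add hn0]
          congr 1
          push_cast
          ring
        calc _ ≤ t / 2 * (C₂ * (n : ℝ) ^ growthExp)
              + t⁻¹ / 2 * (C₁ * (n : ℝ) ^ (((2 * r : ℕ) : ℝ) * growthExp)) := by
              gcongr
              · exact h₂ n hn
              · exact h₁ n hn
          _ = C₂ / 2 * (t * (n : ℝ) ^ growthExp)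
              + C₁ / 2 * (t⁻¹ * (n : ℝ) ^ (((2 * r : ℕ) : ℝ) * growthExp)) := by ring
          _ = _ := by rw [h4, h5]; ring)
    have h6 := h3.add (tendsto_urnMean_leadingStat_pow (r + 1))
    rw [zero_add] at h6
    refine h6.congr fun n => ?_
    rw [urnMean_sub, sub_div, sub_add_cancel]

/-! ### The rescaled sink degree and its limit law -/

theorem integral_sinkDegree_pow (n r : ℕ) :
    ∫ G : Network n, (sinkDegree G : ℝ) ^ r ∂(law n).toMeasure
      = urnMean n fun p s => ((p : ℝ) + s) ^ r := by
  simp_rw [urnMean, sinkDegree_eq, Nat.cast_add]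

/-- The law of the rescaled degree of the sink. -/
noncomputable def rescaledLaw (n : ℕ) : ProbabilityMeasure ℝ :=
  ⟨(law n).toMeasure.map fun G : Network n => (sinkDegree G : ℝ) / (n : ℝ) ^ growthExp,
    Measure.isProbabilityMeasure_map Measurable.of_discrete.aemeasurable⟩

theorem integrable_pow_rescaledLaw (n r : ℕ) :
    Integrable (fun x : ℝ => x ^ r) (rescaledLaw n : Measure ℝ) :=
  (integrable_map_measure (by fun_prop) Measurable.of_discrete.aemeasurable).2 (integrable_law n _)

theorem integral_pow_rescaledLaw (n r : ℕ) :
    ∫ x, x ^ r ∂(rescaledLaw n : Measure ℝ)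
      = urnMean n (fun p s => ((p : ℝ) + s) ^ r) / (n : ℝ) ^ ((r : ℝ) * growthExp) := by
  rw [rescaledLaw, ProbabilityMeasure.coe_mk,
    integral_map Measurable.of_discrete.aemeasurable (by fun_prop), ← integral_sinkDegree_pow,
    ← integral_div]
  simp_rw [div_pow]
  rw [mul_comm (r : ℝ), Real.rpow_mul_natCast (by positivity)]

theorem exists_limit_rescaledLaw :
    ∃ D : ProbabilityMeasure ℝ, HasMoments (D : Measure ℝ) limitMoment ∧
      Tendsto rescaledLaw atTop (𝓝 D) := by
  refine exists_tendsto_of_moments integrable_pow_rescaledLaw (fun r => ?_)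
    tendsto_pow_mul_limitMoment
  simp_rw [integral_pow_rescaledLaw]
  exact tendsto_urnMean_degree_pow r

theorem limitMoment_one : limitMoment 1 = (1 + √2) / 2 / Real.Gamma √2 := by
  have h0 : √2 ≠ 0 := by positivity
  rw [limitMoment, limitCoeff_one, growthExp]
  rw [Nat.factorial_one, Nat.cast_one, one_mul, one_mul, sub_add_cancel]
  field_simp

end BinarySP

/-! ### The main theorem -/

theorem theorem5 :
    -- exact expectation of the sink degree `D_n`
    (∀ n : ℕ, 1 ≤ n →
      Integrable (fun G : BinarySP.Network n => (BinarySP.sinkDegree G : ℝ))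
        (BinarySP.law n).toMeasure ∧
      ∫ G : BinarySP.Network n, (BinarySP.sinkDegree G : ℝ) ∂(BinarySP.law n).toMeasure
        = (1 + √2) / 2 * Ring.choose ((n : ℝ) + √2 - 2) (n - 1)
          - (√2 - 1) / 2 * Ring.choose ((n : ℝ) - √2 - 2) (n - 1)) ∧
    -- its asymptotic behaviour
    ((fun n : ℕ =>
        ∫ G : BinarySP.Network n, (BinarySP.sinkDegree G : ℝ) ∂(BinarySP.law n).toMeasure)
      ~[atTop] fun n : ℕ => (1 + √2) / 2 * ((n : ℝ) ^ (√2 - 1) / Real.Gamma √2)) ∧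
    -- limiting distribution `D` of `D_n / n ^ (√2 - 1)`
    ∃ c : ℕ → ℝ,
      c 0 = 1 ∧ c 1 = (1 + √2) / (2 * √2) ∧
      (∀ r : ℕ, 2 ≤ r → c r = 1 / (((r : ℝ) * (√2 - 1) + 1) ^ 2 - 2) *
        ∑ k ∈ Finset.Icc 1 (r - 1), c k * c (r - k)) ∧
      ∃ (D : Measure ℝ) (_ : IsProbabilityMeasure D),
        TendstoInDistribution
          (fun (n : ℕ) (G : BinarySP.Network n) =>
            (BinarySP.sinkDegree G : ℝ) / (n : ℝ) ^ (√2 - 1))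
          atTop (fun x : ℝ => x) (fun n : ℕ => (BinarySP.law n).toMeasure) D ∧
        -- the moments of `D`
        (∀ r : ℕ, Integrable (fun x : ℝ => x ^ r) D ∧
          ∫ x, x ^ r ∂D = (r.factorial : ℝ) * ((r : ℝ) * (√2 - 1) + 1) * c r
            / Real.Gamma ((r : ℝ) * (√2 - 1) + 1)) ∧
        -- they characterize `D`
        (∀ D' : Measure ℝ, IsProbabilityMeasure D' →
          (∀ r : ℕ, Integrable (fun x : ℝ => x ^ r) D' ∧
            ∫ x, x ^ r ∂D' = (r.factorial : ℝ) * ((r : ℝ) * (√2 - 1) + 1) * c r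
              / Real.Gamma ((r : ℝ) * (√2 - 1) + 1)) →
          D' = D) := by
  have hmean : ∀ n : ℕ, ∫ G : BinarySP.Network n, (BinarySP.sinkDegree G : ℝ)
      ∂(BinarySP.law n).toMeasure = BinarySP.urnMean n fun p s => (p : ℝ) + s := fun n => by
    simpa using BinarySP.integral_sinkDegree_pow n 1
  refine ⟨fun n hn => ⟨BinarySP.integrable_law n _, ?_⟩, ?_, BinarySP.limitCoeff,
    BinarySP.limitCoeff_zero, BinarySP.limitCoeff_one, fun r hr => BinarySP.limitCoeff_rec hr, ?_⟩
  · have h1 : (n : ℝ) - √2 - 2 = n + -√2 - 2 := by ring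
    rw [hmean, BinarySP.urnMean_degree hn, h1, BinarySP.choose_eq_prod _ hn,
      BinarySP.choose_eq_prod _ hn]
  · have hlim := BinarySP.tendsto_urnMean_degree_pow 1
    have hΓ : 0 < Real.Gamma √2 := Real.Gamma_pos_of_pos (by positivity)
    have hc : (1 + √2) / 2 / Real.Gamma √2 ≠ 0 := by positivity
    rw [BinarySP.limitMoment_one] at hlim
    simp_rw [hmean]
    refine isEquivalent_of_tendsto_one ?_
    have h2 := hlim.div_const ((1 + √2) / 2 / Real.Gamma √2)
    rw [div_self hc] at h2
    refine h2.congr fun n => ?_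
    simp only [pow_one, Nat.cast_one, one_mul, BinarySP.growthExp, Pi.div_apply]
    rw [div_div]
    congr 1
    ring
  · obtain ⟨D, hD, hlim⟩ := BinarySP.exists_limit_rescaledLaw
    -- `hD` is the required moment statement after unfolding `HasMoments`, `limitMoment` and
    -- `growthExp`.
    refine ⟨D, D.2, ⟨fun n => Measurable.of_discrete.aemeasurable, aemeasurable_id, ?_⟩, hD, ?_⟩
    · have h1 : (⟨(D : Measure ℝ).map fun x => x,
          Measure.isProbabilityMeasure_map aemeasurable_id⟩ : ProbabilityMeasure ℝ) = D :=
        Subtype.ext Measure.map_id'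
      rw [h1]
      exact hlim
    · intro D' hD' hmom
      exact BinarySP.HasMoments.unique (μ := D') (ν := D) hmom hD
        BinarySP.tendsto_pow_mul_limitMoment
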